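/- **Setting.** Let $\mathcal G$ be a finite pattern of curves on the flat torus $\mathbb T^2=\mathbb R^2/\mathbb Z^2$: each $\gamma\in\mathcal G$ is a simple $C^2$ curve, regular up to its end points and parametrized by arc length $s\in[0,L_\gamma]$, $L_\gamma>0$ (closed curves are allowed and carry one marked point, which counts as both end points), and two curves of $\mathcal G$ meet at most at end points (nodes). Assume that $\mathcal G$ is regular: at each node the arc ends that approach it have pairwise distinct directions (no two are tangent). Let $\Gamma_1$ be the union of the curves, $l=\sum_\gamma L_\gamma$ its total length, and $\int_{\Gamma_1}$ integration with respect to arc length; derivatives $(\cdot)_s$ are taken along the arcs. **Effective tensor.** Let $a>0$, $\square=(0,1)^2$, and let $Z$ be the space of $v\in H^1_{per}(\square)$ (the completion of the smooth $1$-periodic functions in $H^1(\square)$) with $\int_\square v=0$ whose trace on each $\gamma\in\mathcal G$ lies in $H^1(\gamma)$. For $k=1,2$ let $\hat w_k\in Z$ be the weak solution of $$\int_\square\nabla v\cdot\nabla\hat w_k+a\int_{\Gamma_1}v_s(\hat w_k)_s+a\int_{\Gamma_1}v_s(x_k)_s=0\qquad\text{for all }v\in Z,$$ and put $(\Sigma_0)_{kl}=\delta_{kl}+a\int_{\Gamma_1}(\hat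 w_k+x_k)_s(x_l)_s\,ds$. **Graph spaces.** For $o\in\mathbb R^2$ let $\Gamma_1^\#=\Gamma_1^\#(o)$ be the part of the $1$-periodic extension of the pattern in the closed cell $o+[0,1]^2$ (the union of the arcs into which the cell cuts the pattern; of an arc lying on the boundary of the cell only the copy in $o+[0,1)^2$ is kept). Let $\mathcal M^1$ be the space of functions on $\Gamma_1^\#$ that are $H^1$ along each arc of $\Gamma_1^\#$ and whose values along the arcs joining at a node in the open cell agree there, with inner product $\int uv+u_sv_s$. Let $\mathcal M^1_{per}\subset\mathcal M^1$ be the subspace of the functions that come from $\Gamma_1\subset\mathbb T^2$, are $H^1$ along each $\gamma\in\mathcal G$, and whose values agree at every node of the torus. Let $K^1=\{u\in\mathcal M^1: u_s=0\}$ and let $M^1=(K^1)^\perp\subset\mathcal M^1$ be equipped with the inner product $\langle u,v\rangle=\int u_sv_s$; let $M^1_{per}\subset M^1$ be the image of $\mathcal M^1_{per}$ under the orthogonal projection of $\mathcal M^1$ onto $M^1$. Let $d_k^\#(o)$ be the $\langle\cdot,\cdot\rangle$-distance from the projection of the coordinate function $x_k\in\mathcal M^1$ onto $M^1$ to $M^1_{per}$.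 **Theorem.** Suppose that for some $o$ the set $\Gamma_1^\#(o)$ is connected and some arc of the pattern crosses the boundary of the unit cell, i.e. no lift of the arc to $\mathbb R^2$ stays in one closed cell $o+n+[0,1]^2$, $n\in\mathbb Z^2$, or the arc is a closed curve that is not closed in $\mathbb R^2$. Then the maximum $$d^2=\max_{o'\in\mathbb R^2}\bigl(d_1^\#(o')^2+d_2^\#(o')^2\bigr),\qquad d\ge 0,$$ exists, $0<d\le\sqrt l$, and for every $a>0$ the tensor $\Sigma_0$ exists, is unique, and satisfies $$2+d^2a\le\operatorname{tr}(\Sigma_0)\le 2+la .$$ -/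

import Mathlib

open MeasureTheory Set Filter Topology
open scoped ContDiff ENNReal

noncomputable section

/-- The Euclidean plane; the flat torus is its quotient by the integer lattice. -/
abbrev Plane : Type := EuclideanSpace ℝ (Fin 2)

/-- An integer vector as a point of the plane. -/
def latticeVec (n : Fin 2 → ℤ) : Plane := WithLp.toLp 2 (fun j => (n j : ℝ))

/-- The open unit cell `(0,1)²`. -/
def unitCell : Set Plane := {x | ∀ j, 0 < x j ∧ x j < 1}

/-- The open unit cell `o + (0,1)²` of the coordinate system translated to the origin `o`. -/
def openCell (o : Plane) : Set Plane := {x | ∀ j, o j < x j ∧ x j < o j + 1}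

/-- The closed unit cell `o + [0,1]²` of the coordinate system translated to the origin `o`. -/
def closedCell (o : Plane) : Set Plane := {x | ∀ j, o j ≤ x j ∧ x j ≤ o j + 1}

/-- The unique integer vector `n` such that `y - n` lies in the half-open cell `o + [0,1)²`. -/
def cellIndex (o y : Plane) : Fin 2 → ℤ := fun j => ⌊y j - o j⌋

/-- A finite pattern of `C²` curves on the flat torus `ℝ²/ℤ²`. Each curve is given by a lift to
the plane with unit speed, `C²` up to the end points. The curves are simple, and two of them (or
one of them with itself) meet on the torus at most at end points. A closed curve, smooth or with a
conic point, is a curve whose two end points agree on the torus. -/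
structure TorusPattern (ι : Type*) where
  len : ι → ℝ
  len_pos : ∀ i, 0 < len i
  arc : ι → ℝ → Plane
  contDiffOn : ∀ i, ContDiffOn ℝ 2 (arc i) (Icc 0 (len i))
  unit_speed : ∀ i, ∀ t ∈ Icc 0 (len i), ‖derivWithin (arc i) (Icc 0 (len i)) t‖ = 1
  meet_at_ends : ∀ i j, ∀ s ∈ Icc 0 (len i), ∀ t ∈ Icc 0 (len j), ∀ n : Fin 2 → ℤ,
    arc i s = arc j t + latticeVec n →
      (i = j ∧ s = t) ∨ ((s = 0 ∨ s = len i) ∧ (t = 0 ∨ t = len j))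

namespace TorusPattern

variable {ι : Type*} (P : TorusPattern ι)

/-- The unit tangent `d/ds` of the arc `i`, as a function of arc length. -/
def tangent (i : ι) (t : ℝ) : Plane := derivWithin (P.arc i) (Icc 0 (P.len i)) t

/-- The parameter of the initial (`false`) or final (`true`) end of the arc `i`. -/
def endParam (i : ι) (e : Bool) : ℝ := if e then P.len i else 0

/-- The position of an end of an arc, in the chosen lift. -/
def endPoint (i : ι) (e : Bool) : Plane := P.arc i (P.endParam i e)

/-- The unit tangent at an end of an arc, pointing from the node into the arc. -/
def outTangent (i : ι) (e : Bool) : Plane :=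
  if e then -P.tangent i (P.len i) else P.tangent i 0

/-- Regularity: distinct arc ends which approach the same node of the torus have distinct
directions there, i.e. they are mutually nontangential (they enclose a positive angle). -/
def IsRegular : Prop :=
  ∀ i e j e', (i, e) ≠ (j, e') → ∀ n : Fin 2 → ℤ,
    P.endPoint i e = P.endPoint j e' + latticeVec n → P.outTangent i e ≠ P.outTangent j e'

/-- The total length of the pattern. -/
def totalLength [Fintype ι] : ℝ := ∑ i, P.len i

/-! ### The cell problem and the effective tensor -/

end TorusPattern

/-- The data of an element of the space `Z` below: a function on the plane, its gradient, its
trace on the arcs (as a function of arc length), and the arc-length derivative of the trace. -/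
structure CellField (ι : Type*) where
  val : Plane → ℝ
  grad : Plane → Plane
  trace : ι → ℝ → ℝ
  traceDeriv : ι → ℝ → ℝ

namespace TorusPattern

variable {ι : Type*} (P : TorusPattern ι)

/-- Membership in `Z`: the function `val` lies in `H¹_per`, the completion of the smooth
1-periodic functions in the norm of `H¹` of the cell, with weak gradient `grad`; its trace on each
arc, i.e. the `L²` limit of the restrictions of approximating smooth functions, is `trace`; the
trace is in `H¹` of each arc (`trace` is its continuous representative) with derivative
`traceDeriv`; and `val` has mean zero. -/
structure MemZ (w : CellField ι) : Prop where
  val_memLp : MemLp w.val 2 (volume.restrict unitCell)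
  grad_memLp : MemLp w.grad 2 (volume.restrict unitCell)
  trace_memLp : ∀ i, MemLp (w.trace i) 2 (volume.restrict (Icc 0 (P.len i)))
  traceDeriv_memLp : ∀ i, MemLp (w.traceDeriv i) 2 (volume.restrict (Icc 0 (P.len i)))
  approx : ∃ φ : ℕ → Plane → ℝ,
    (∀ m, ContDiff ℝ ∞ (φ m)) ∧
    (∀ m (n : Fin 2 → ℤ) x, φ m (x + latticeVec n) = φ m x) ∧
    Tendsto (fun m => eLpNorm (fun x => φ m x - w.val x) 2 (volume.restrict unitCell))
      atTop (𝓝 0) ∧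
    Tendsto (fun m => eLpNorm (fun x => gradient (φ m) x - w.grad x) 2
      (volume.restrict unitCell)) atTop (𝓝 0) ∧
    ∀ i, Tendsto (fun m => eLpNorm (fun t => φ m (P.arc i t) - w.trace i t) 2
      (volume.restrict (Icc 0 (P.len i)))) atTop (𝓝 0)
  trace_eq : ∀ i, ∀ s ∈ Icc 0 (P.len i), ∀ t ∈ Icc 0 (P.len i),
    w.trace i t - w.trace i s = ∫ x in s..t, w.traceDeriv i x
  mean_zero : ∫ x in unitCell, w.val x = 0

/-- `w` is the weak solution `ŵ_k ∈ Z` of the effective corrector equation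
`∫ ∇v·∇ŵ_k + a ∫_Γ v_s (ŵ_k)_s + a ∫_Γ v_s (x_k)_s = 0` for all `v ∈ Z`. -/
def IsCorrector [Fintype ι] (a : ℝ) (k : Fin 2) (w : CellField ι) : Prop :=
  P.MemZ w ∧ ∀ v : CellField ι, P.MemZ v →
    (∫ x in unitCell, inner ℝ (v.grad x) (w.grad x))
      + a * (∑ i, ∫ t in (0 : ℝ)..P.len i, v.traceDeriv i t * w.traceDeriv i t)
      + a * (∑ i, ∫ t in (0 : ℝ)..P.len i, v.traceDeriv i t * P.tangent i t k) = 0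

/-- `S` is the effective diffusion tensor `S_kl = δ_kl + a ∫_Γ (ŵ_k + x_k)_s (x_l)_s`. -/
def IsEffectiveTensor [Fintype ι] (a : ℝ) (S : Matrix (Fin 2) (Fin 2) ℝ) : Prop :=
  ∃ w : Fin 2 → CellField ι, (∀ k, P.IsCorrector a k (w k)) ∧
    ∀ k l, S k l = (if k = l then 1 else 0)
      + a * ∑ i, ∫ t in (0 : ℝ)..P.len i,
          ((w k).traceDeriv i t + P.tangent i t k) * P.tangent i t l

/-! ### The pattern in the closed unit cell of a translated coordinate system -/

/-- The stretch `[s,t]` of the arc `i`, moved by `-n`, belongs to the pattern in the closed cell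
`o + [0,1]²`. Of a stretch lying along the boundary of the cell one copy is kept, the one in
`o + [0,1)²`; a stretch which only touches the sides outside `o + [0,1)²` is not cut there. -/
def IsPiece (o : Plane) (i : ι) (n : Fin 2 → ℤ) (s t : ℝ) : Prop :=
  s < t ∧ Icc s t ⊆ Icc 0 (P.len i) ∧
    (∀ x ∈ Icc s t, P.arc i x - latticeVec n ∈ closedCell o) ∧
    ∀ᵐ x ∂(volume.restrict (Icc s t)), cellIndex o (P.arc i x) = n

/-- The set `Γ₁^#`: the union of all arcs of the pattern in the closed cell. -/
def cellGraph (o : Plane) : Set Plane :=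
  {y | ∃ i n s t, P.IsPiece o i n s t ∧ ∃ x ∈ Icc s t, y = P.arc i x - latticeVec n}

/-- The arc `i` crosses the boundary of the unit cell: its lift does not stay in one closed cell
of the translated lattice of cells, or the arc is a closed curve that winds around the torus (so
that, followed periodically, it leaves every cell). -/
def ArcCrosses (o : Plane) (i : ι) : Prop :=
  (¬ ∃ n : Fin 2 → ℤ, ∀ t ∈ Icc 0 (P.len i), P.arc i t - latticeVec n ∈ closedCell o) ∨
    ∃ n : Fin 2 → ℤ, n ≠ 0 ∧ P.arc i (P.len i) = P.arc i 0 + latticeVec n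

/-! ### The graph spaces -/

/-- `L²` of the pattern with respect to arc length. As cutting the pattern at the boundary of
a cell does not change it up to null sets, this is also `L²(Γ₁^#)`. -/
abbrev ArcL2 [Fintype ι] : Type _ :=
  PiLp 2 (fun i : ι => Lp ℝ 2 (volume.restrict (Icc (0 : ℝ) (P.len i))))

/-- Pairs (function, derivative) in `L² × L²`, with inner product `∫_Γ u v + u_s v_s`. -/
abbrev GraphL2 [Fintype ι] : Type _ := WithLp 2 (P.ArcL2 × P.ArcL2)

lemma intervalIntegrable_coe {L : ℝ} (f : Lp ℝ 2 (volume.restrict (Icc (0 : ℝ) L))) {s t : ℝ}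
    (hs : s ∈ Icc 0 L) (ht : t ∈ Icc 0 L) : IntervalIntegrable f volume s t := by
  have h1 : Integrable f (volume.restrict (Icc (0 : ℝ) L)) :=
    (Lp.memLp f).integrable (by norm_num)
  have h2 : IntegrableOn f (Icc (0 : ℝ) L) volume := h1
  exact (h2.mono_set (uIcc_subset_Icc hs ht)).intervalIntegrable

lemma ae_of_ae_Icc {L : ℝ} {p : ℝ → Prop} {s t : ℝ} (hs : s ∈ Icc 0 L) (ht : t ∈ Icc 0 L)
    (h : ∀ᵐ x ∂(volume.restrict (Icc (0 : ℝ) L)), p x) :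
    ∀ᵐ x ∂volume, x ∈ Set.uIoc s t → p x := by
  have h1 := (ae_restrict_iff' measurableSet_Icc).1 h
  filter_upwards [h1] with x hx hmem
  exact hx (uIcc_subset_Icc hs ht (uIoc_subset_uIcc hmem))

lemma integral_coe_add {L : ℝ} (f g : Lp ℝ 2 (volume.restrict (Icc (0 : ℝ) L))) {s t : ℝ}
    (hs : s ∈ Icc 0 L) (ht : t ∈ Icc 0 L) :
    ∫ x in s..t, (f + g : Lp ℝ 2 (volume.restrict (Icc (0 : ℝ) L))) x
      = (∫ x in s..t, f x) + ∫ x in s..t, g x := by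
  rw [← intervalIntegral.integral_add (intervalIntegrable_coe f hs ht)
    (intervalIntegrable_coe g hs ht)]
  refine intervalIntegral.integral_congr_ae ?_
  filter_upwards [ae_of_ae_Icc hs ht (Lp.coeFn_add f g)] with x hx hmem
  simpa using hx hmem

lemma integral_coe_smul {L : ℝ} (c : ℝ) (f : Lp ℝ 2 (volume.restrict (Icc (0 : ℝ) L))) {s t : ℝ}
    (hs : s ∈ Icc 0 L) (ht : t ∈ Icc 0 L) :
    ∫ x in s..t, (c • f : Lp ℝ 2 (volume.restrict (Icc (0 : ℝ) L))) x = c * ∫ x in s..t, f x := by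
  rw [← intervalIntegral.integral_const_mul]
  refine intervalIntegral.integral_congr_ae ?_
  filter_upwards [ae_of_ae_Icc hs ht (Lp.coeFn_smul c f)] with x hx hmem
  simpa using hx hmem

lemma integral_coe_zero {L : ℝ} {s t : ℝ} (hs : s ∈ Icc 0 L) (ht : t ∈ Icc 0 L) :
    ∫ x in s..t, (0 : Lp ℝ 2 (volume.restrict (Icc (0 : ℝ) L))) x = 0 := by
  rw [intervalIntegral.integral_congr_ae (g := fun _ => (0 : ℝ))]
  · simp
  · filter_upwards [ae_of_ae_Icc hs ht
      (Lp.coeFn_zero ℝ 2 (volume.restrict (Icc (0 : ℝ) L)))] with x hx hmem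
    simpa using hx hmem

/-- `u` is the representative of `p` in the graph space `𝓜¹(Γ₁^#)`: `u i n t` is the value at the
point `arc i t - n` of the closed cell; `u` is absolutely continuous with derivative `p.snd` along
every arc of the cell; and at every node in the open cell the values along all arcs that join
there agree. -/
structure IsCellRep [Fintype ι] (o : Plane) (p : P.GraphL2) (u : ι → (Fin 2 → ℤ) → ℝ → ℝ) :
    Prop where
  ae_eq : ∀ i, p.fst i =ᵐ[volume.restrict (Icc (0 : ℝ) (P.len i))]
    fun t => u i (cellIndex o (P.arc i t)) t
  eq_integral : ∀ i n s t, P.IsPiece o i n s t → u i n t - u i n s = ∫ x in s..t, p.snd i x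
  match_nodes : ∀ i n e j m e', P.endPoint i e - latticeVec n = P.endPoint j e' - latticeVec m →
    P.endPoint i e - latticeVec n ∈ openCell o →
    u i n (P.endParam i e) = u j m (P.endParam j e')

/-- `u` is the representative of `p` in `𝓜¹_per(Γ₁)`: `u i` is absolutely continuous with
derivative `p.snd` along the whole arc `i`, and at every node of the torus the values along all
arcs that join there agree. -/
structure IsPerRep [Fintype ι] (p : P.GraphL2) (u : ι → ℝ → ℝ) : Prop where
  ae_eq : ∀ i, p.fst i =ᵐ[volume.restrict (Icc (0 : ℝ) (P.len i))] u i
  eq_integral : ∀ i, ∀ s ∈ Icc 0 (P.len i), ∀ t ∈ Icc 0 (P.len i),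
    u i t - u i s = ∫ x in s..t, p.snd i x
  match_nodes : ∀ i e j e', ∀ n : Fin 2 → ℤ, P.endPoint i e = P.endPoint j e' + latticeVec n →
    u i (P.endParam i e) = u j (P.endParam j e')

lemma IsPiece.mem_left {o : Plane} {i : ι} {n : Fin 2 → ℤ} {s t : ℝ} (h : P.IsPiece o i n s t) :
    s ∈ Icc 0 (P.len i) := h.2.1 (left_mem_Icc.2 h.1.le)

lemma IsPiece.mem_right {o : Plane} {i : ι} {n : Fin 2 → ℤ} {s t : ℝ}
    (h : P.IsPiece o i n s t) : t ∈ Icc 0 (P.len i) := h.2.1 (right_mem_Icc.2 h.1.le)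

/-- The graph space `𝓜¹(Γ₁^#)` in the cell with origin `o`. -/
def cellSpace [Fintype ι] (o : Plane) : Submodule ℝ P.GraphL2 where
  carrier := {p | ∃ u, P.IsCellRep o p u}
  zero_mem' := by
    refine ⟨fun _ _ _ => 0, fun i => ?_, fun i n s t h => ?_, fun _ _ _ _ _ _ _ _ => rfl⟩
    · exact Lp.coeFn_zero ℝ 2 _
    · simpa using (integral_coe_zero (h.mem_left P) (h.mem_right P)).symm
  add_mem' := by
    rintro p q ⟨u, hu⟩ ⟨v, hv⟩
    refine ⟨fun i n t => u i n t + v i n t, fun i => ?_, fun i n s t h => ?_,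
      fun i n e j m e' h1 h2 => ?_⟩
    · have h := Lp.coeFn_add (p.fst i) (q.fst i)
      filter_upwards [h, hu.ae_eq i, hv.ae_eq i] with t h1 h2 h3
      rw [← h2, ← h3]
      exact h1
    · have h1 := hu.eq_integral i n s t h
      have h2 := hv.eq_integral i n s t h
      have h3 := integral_coe_add (p.snd i) (q.snd i) (h.mem_left P) (h.mem_right P)
      have h4 : (p + q).snd i = p.snd i + q.snd i := rfl
      rw [h4, h3]
      linarith
    · simp only [hu.match_nodes i n e j m e' h1 h2, hv.match_nodes i n e j m e' h1 h2]
  smul_mem' := by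
    rintro c p ⟨u, hu⟩
    refine ⟨fun i n t => c * u i n t, fun i => ?_, fun i n s t h => ?_,
      fun i n e j m e' h1 h2 => ?_⟩
    · have h := Lp.coeFn_smul c (p.fst i)
      filter_upwards [h, hu.ae_eq i] with t h1 h2
      rw [← h2]
      exact h1
    · have h1 := hu.eq_integral i n s t h
      have h3 := integral_coe_smul c (p.snd i) (h.mem_left P) (h.mem_right P)
      have h4 : (c • p).snd i = c • p.snd i := rfl
      rw [h4, h3, ← h1]
      ring
    · simp only [hu.match_nodes i n e j m e' h1 h2]

/-- The periodic graph space `𝓜¹_per(Γ₁)`. -/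
def perSpace [Fintype ι] : Submodule ℝ P.GraphL2 where
  carrier := {p | ∃ u, P.IsPerRep p u}
  zero_mem' := by
    refine ⟨fun _ _ => 0, fun i => ?_, fun i s hs t ht => ?_, fun _ _ _ _ _ _ => rfl⟩
    · exact Lp.coeFn_zero ℝ 2 _
    · simpa using (integral_coe_zero hs ht).symm
  add_mem' := by
    rintro p q ⟨u, hu⟩ ⟨v, hv⟩
    refine ⟨fun i t => u i t + v i t, fun i => ?_, fun i s hs t ht => ?_,
      fun i e j e' n h => ?_⟩
    · have h := Lp.coeFn_add (p.fst i) (q.fst i)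
      filter_upwards [h, hu.ae_eq i, hv.ae_eq i] with t h1 h2 h3
      rw [← h2, ← h3]
      exact h1
    · have h1 := hu.eq_integral i s hs t ht
      have h2 := hv.eq_integral i s hs t ht
      have h3 := integral_coe_add (p.snd i) (q.snd i) hs ht
      have h4 : (p + q).snd i = p.snd i + q.snd i := rfl
      rw [h4, h3]
      linarith
    · simp only [hu.match_nodes i e j e' n h, hv.match_nodes i e j e' n h]
  smul_mem' := by
    rintro c p ⟨u, hu⟩
    refine ⟨fun i t => c * u i t, fun i => ?_, fun i s hs t ht => ?_,
      fun i e j e' n h => ?_⟩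
    · have h := Lp.coeFn_smul c (p.fst i)
      filter_upwards [h, hu.ae_eq i] with t h1 h2
      rw [← h2]
      exact h1
    · have h1 := hu.eq_integral i s hs t ht
      have h3 := integral_coe_smul c (p.snd i) hs ht
      have h4 : (c • p).snd i = c • p.snd i := rfl
      rw [h4, h3, ← h1]
      ring
    · simp only [hu.match_nodes i e j e' n h]

/-- The canonical inclusion `𝓜¹_per ↪ 𝓜¹`. -/
lemma perSpace_le_cellSpace [Fintype ι] (o : Plane) : P.perSpace ≤ P.cellSpace o := by
  rintro p ⟨u, hu⟩
  refine ⟨fun i _ t => u i t, hu.ae_eq, fun i n s t h =>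
    hu.eq_integral i s (h.mem_left P) t (h.mem_right P), fun i n e j m e' h _ => ?_⟩
  refine hu.match_nodes i e j e' (fun k => n k - m k) ?_
  have h1 : P.endPoint i e = P.endPoint j e' - latticeVec m + latticeVec n := by
    rw [← h]; abel
  rw [h1]
  ext k
  simp [latticeVec]
  ring

/-- `K¹`, the functions of `𝓜¹` whose derivative vanishes. -/
def kernelSpace [Fintype ι] (o : Plane) : Submodule ℝ P.GraphL2 :=
  P.cellSpace o ⊓ LinearMap.ker (WithLp.sndₗ 2 ℝ P.ArcL2 P.ArcL2)

instance hasOrthogonalProjection_kernelSpace [Fintype ι] (o : Plane) :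
    (P.kernelSpace o)ᗮ.HasOrthogonalProjection :=
  haveI : CompleteSpace (P.kernelSpace o)ᗮ :=
    Submodule.instOrthogonalCompleteSpace (P.kernelSpace o)
  Submodule.HasOrthogonalProjection.ofCompleteSpace _

/-- The orthogonal projection of `𝓜¹` onto `M¹ = 𝓜¹ ∩ (K¹)^⊥`, as the restriction of a projection
of the ambient Hilbert space. -/
def cellProj [Fintype ι] (o : Plane) : P.GraphL2 →L[ℝ] P.GraphL2 :=
  (P.kernelSpace o)ᗮ.starProjection

/-- `M¹_per`, the image of the periodic space `𝓜¹_per` in `M¹` (functions modulo `K¹`). -/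
def perSubspace [Fintype ι] (o : Plane) : Submodule ℝ P.GraphL2 :=
  P.perSpace.map (P.cellProj o : P.GraphL2 →ₗ[ℝ] P.GraphL2)

lemma continuousOn_tangent (i : ι) : ContinuousOn (P.tangent i) (Icc 0 (P.len i)) :=
  (P.contDiffOn i).continuousOn_derivWithin (uniqueDiffOn_Icc (P.len_pos i)) (by norm_num)

lemma memLp_coord (o : Plane) (k : Fin 2) (i : ι) :
    MemLp (fun t => P.arc i t k - (cellIndex o (P.arc i t) k : ℝ)) 2
      (volume.restrict (Icc (0 : ℝ) (P.len i))) := by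
  have hc : ContinuousOn (fun t => P.arc i t k) (Icc 0 (P.len i)) :=
    (EuclideanSpace.proj (𝕜 := ℝ) k).continuous.comp_continuousOn (P.contDiffOn i).continuousOn
  have hm : AEMeasurable (fun t => P.arc i t k) (volume.restrict (Icc (0 : ℝ) (P.len i))) :=
    hc.aemeasurable measurableSet_Icc
  have hf : Measurable (fun y : ℝ => y - (⌊y - o k⌋ : ℝ)) := by
    refine measurable_id.sub ?_
    exact (measurable_from_top (f := fun z : ℤ => (z : ℝ))).comp
      (Int.measurable_floor.comp (measurable_id.sub_const _))
  refine MemLp.of_bound (hf.comp_aemeasurable hm).aestronglyMeasurable (|o k| + 1)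
    (Eventually.of_forall fun t => ?_)
  have h1 := Int.floor_le (P.arc i t k - o k)
  have h2 := Int.lt_floor_add_one (P.arc i t k - o k)
  have h3 := neg_abs_le (o k)
  have h4 := le_abs_self (o k)
  rw [Real.norm_eq_abs, abs_le]
  simp only [cellIndex]
  constructor <;> linarith

lemma memLp_tangent (k : Fin 2) (i : ι) :
    MemLp (fun t => P.tangent i t k) 2 (volume.restrict (Icc (0 : ℝ) (P.len i))) := by
  have hc : ContinuousOn (fun t => P.tangent i t k) (Icc 0 (P.len i)) :=
    (EuclideanSpace.proj (𝕜 := ℝ) k).continuous.comp_continuousOn (P.continuousOn_tangent i)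
  refine MemLp.of_bound (hc.aestronglyMeasurable measurableSet_Icc) 1 ?_
  refine (ae_restrict_iff' measurableSet_Icc).2 (Eventually.of_forall fun t ht => ?_)
  exact (PiLp.norm_apply_le (P.tangent i t) k).trans (P.unit_speed i t ht).le

/-- The coordinate function `x_k` on `Γ₁^#`, with its derivative `(x_k)_s`. -/
def coordFun [Fintype ι] (o : Plane) (k : Fin 2) : P.GraphL2 :=
  WithLp.toLp 2
    (WithLp.toLp 2 fun i => (P.memLp_coord o k i).toLp _,
      WithLp.toLp 2 fun i => (P.memLp_tangent k i).toLp _)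

/-- `d_k^#`: the distance, in the norm `(∫ u_s²)^(1/2)` of `M¹`, from the projection of `x_k` to
`M¹` to the subspace `M¹_per`. -/
def cellDist [Fintype ι] (o : Plane) (k : Fin 2) : ℝ :=
  Metric.infDist (P.cellProj o (P.coordFun o k)).snd
    ((fun p : P.GraphL2 => p.snd) '' (P.perSubspace o : Set P.GraphL2))

end TorusPattern

end

/-! Both halves of the theorem reduce to one closed subspace of `L²` of the arcs, `perDerivs`: the
arc length derivatives of periodic functions on the pattern.

Distances. Elements of `K¹` have zero derivative, so projecting onto `M¹` changes no derivative
(`snd_cellProj`). Hence `d_k^#(o)` is the `L²` distance from `(x_k)_s` to `perDerivs`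
(`cellDist_eq`), whatever `o` is: the maximum is over a constant function. It is at most `√l`
because `0` is periodic and the tangents have unit length. It is positive by contradiction:
`perDerivs` is closed, so distance zero gives periodic `u_k` with `(u_k)_s = (x_k)_s`. Then `x_k -
u_k` is constant on the connected graph in the cell, so all pieces of an arc lie in the same lattice
cell and no arc can cross (`not_forall_tangentL2_mem_perDerivs`).

Tensor. Map `Z` to pairs (gradient, `√a` times the derivative of the trace). The corrector equation
says that minus the image of `ŵ_k` is the orthogonal projection of the source `(0, √a (x_k)_s)` onto
the image of `Z` (`isCorrector_iff`), and `(Σ₀)_kk - 1` is the squared norm of the remainder. This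
norm is at most that of the source, which gives `2 + la`. It is at least `√a` times the distance
from `(x_k)_s` to `perDerivs`, because traces of elements of `Z` are periodic functions on the
graph; this gives `2 + d²a`.

Two analytic facts support this. Traces along arcs sharing a node agree there
(`trace_eq_of_endPoint_eq`): by a scale invariant estimate, averages over short stretches of length
`r` at the node differ by at most ten times the Dirichlet norm, uniformly in `r`; applied to the
difference from a smooth approximant, this forces equality as `r → 0`. And the image of `Z` is
closed (`isClosed_energySubmodule`), since gradient and trace derivative control the whole field
(`exists_norm_le_of_mem_fieldSubmodule`). -/

noncomputable section

/-! ### Elementary estimates for interval integrals -/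

/-- Cauchy–Schwarz, read off from the nonnegativity of the variance of `f` about its mean `m`. -/
lemma sq_integral_le_mul_integral_sq {f : ℝ → ℝ} (hf : Continuous f) {a b : ℝ} (hab : a < b) :
    (∫ x in a..b, f x) ^ 2 ≤ (b - a) * ∫ x in a..b, f x ^ 2 := by
  set m := (∫ x in a..b, f x) / (b - a) with hm
  have hba : 0 < b - a := sub_pos.2 hab
  have h0 : 0 ≤ ∫ x in a..b, (f x - m) ^ 2 :=
    intervalIntegral.integral_nonneg hab.le fun _ _ => sq_nonneg _
  have h1 : ∫ x in a..b, (f x - m) ^ 2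
      = (∫ x in a..b, f x ^ 2) - 2 * m * (∫ x in a..b, f x) + m ^ 2 * (b - a) := by
    have : ∀ x, (f x - m) ^ 2 = f x ^ 2 - 2 * m * f x + m ^ 2 := fun x => by ring
    simp_rw [this]
    rw [intervalIntegral.integral_add, intervalIntegral.integral_sub,
      intervalIntegral.integral_const_mul, intervalIntegral.integral_const]
    · simp; ring
    all_goals exact Continuous.intervalIntegrable (by fun_prop) _ _
  have h2 : (∫ x in a..b, f x) = m * (b - a) := by rw [hm]; field_simp
  rw [h1, h2] at h0
  rw [h2]
  nlinarith

lemma abs_integral_le_of_mem {g : ℝ → ℝ} (hg : Continuous g) (h0 : ∀ x, 0 ≤ g x) {a b x y : ℝ}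
    (hx : x ∈ Icc a b) (hy : y ∈ Icc a b) : |∫ z in x..y, g z| ≤ ∫ z in a..b, g z := by
  have hab : a ≤ b := hx.1.trans hx.2
  refine (intervalIntegral.abs_integral_mono_interval (c := a) (d := b) ?_ ?_ ?_).trans_eq ?_
  · rw [uIoc_of_le hab]
    exact Ioc_subset_Ioc (le_min hx.1 hy.1) (max_le hx.2 hy.2)
  · exact Eventually.of_forall h0
  · exact hg.intervalIntegrable _ _
  · exact abs_of_nonneg (intervalIntegral.integral_nonneg hab fun z _ => h0 z)

/-- A function deviates from its mean over an interval at most by the integral of `|h'|`. -/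
lemma abs_sub_average_le {h h' : ℝ → ℝ} (hd : ∀ x, HasDerivAt h (h' x) x) (hc : Continuous h')
    {a b x : ℝ} (hab : a < b) (hx : x ∈ Icc a b) :
    |h x - (b - a)⁻¹ * ∫ y in a..b, h y| ≤ ∫ y in a..b, |h' y| := by
  have hba : 0 < b - a := sub_pos.2 hab
  have hcont : Continuous h := continuous_iff_continuousAt.2 fun x => (hd x).continuousAt
  have hpt : ∀ y ∈ Icc a b, |h x - h y| ≤ ∫ z in a..b, |h' z| := by
    intro y hy
    rw [← intervalIntegral.integral_eq_sub_of_hasDerivAt (fun z _ => hd z)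
      (hc.intervalIntegrable y x)]
    refine (intervalIntegral.norm_integral_le_abs_integral_norm (f := h') (a := y) (b := x)
      (μ := volume)).trans ?_
    exact abs_integral_le_of_mem hc.norm (fun _ => norm_nonneg _) hy hx
  have h1 : h x - (b - a)⁻¹ * ∫ y in a..b, h y = (b - a)⁻¹ * ∫ y in a..b, (h x - h y) := by
    rw [intervalIntegral.integral_sub (by simp) (hcont.intervalIntegrable _ _)]
    simp
    field_simp
  rw [h1, abs_mul, abs_of_pos (inv_pos.2 hba), inv_mul_le_iff₀ hba]
  have := intervalIntegral.norm_integral_le_of_norm_le_const (a := a) (b := b)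
    (f := fun y => h x - h y) (C := ∫ z in a..b, |h' z|) fun y hy => by
      rw [uIoc_of_le hab.le] at hy
      exact hpt y (Ioc_subset_Icc_self hy)
  rw [abs_of_pos hba] at this
  rw [mul_comm]
  exact this

/-! ### Functions on rectangles, with iterated integrals -/

section Rectangle

variable {f fx fy : ℝ → ℝ → ℝ}

lemma continuous_integral_right (hf : Continuous (Function.uncurry f)) (c d : ℝ) :
    Continuous fun x => ∫ y in c..d, f x y :=
  intervalIntegral.continuous_parametric_intervalIntegral_of_continuous' hf c d

lemma continuous_uncurry_flip (hf : Continuous (Function.uncurry f)) :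
    Continuous (Function.uncurry fun y x => f x y) := hf.comp continuous_swap

lemma integral_integral_comm (hf : Continuous (Function.uncurry f)) (a b c d : ℝ) :
    ∫ x in a..b, ∫ y in c..d, f x y = ∫ y in c..d, ∫ x in a..b, f x y :=
  intervalIntegral_intervalIntegral_swap
    ((hf.continuousOn.integrableOn_compact (isCompact_uIcc.prod isCompact_uIcc)).mono_set
      (prod_mono uIoc_subset_uIcc uIoc_subset_uIcc))

lemma sq_integral_integral_le (hf : Continuous (Function.uncurry f)) {a b c d : ℝ} (hab : a < b)
    (hcd : c < d) : (∫ x in a..b, ∫ y in c..d, f x y) ^ 2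
      ≤ (b - a) * (d - c) * ∫ x in a..b, ∫ y in c..d, f x y ^ 2 := by
  refine (sq_integral_le_mul_integral_sq (continuous_integral_right hf c d) hab).trans ?_
  rw [mul_assoc]
  refine mul_le_mul_of_nonneg_left ?_ (sub_pos.2 hab).le
  rw [← intervalIntegral.integral_const_mul]
  refine intervalIntegral.integral_mono_on hab.le ?_ ?_ fun x _ =>
    sq_integral_le_mul_integral_sq (by fun_prop) hcd
  · exact ((continuous_integral_right hf c d).pow 2).intervalIntegrable _ _
  · refine Continuous.intervalIntegrable (continuous_const.mul
      (continuous_integral_right (f := fun x y => f x y ^ 2) ?_ c d)) _ _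
    exact hf.pow 2

/-- For each fixed `y` this is the one-dimensional estimate `abs_sub_average_le` in `x`; integrating
over `y` and exchanging the integrals gives the claim. -/
lemma abs_slice_sub_average_le (hf : Continuous (Function.uncurry f))
    (hfx : Continuous (Function.uncurry fx))
    (hdx : ∀ x y, HasDerivAt (fun x => f x y) (fx x y) x) {a b c d x : ℝ} (hab : a < b)
    (hcd : c < d) (hx : x ∈ Icc a b) :
    |(∫ y in c..d, f x y) - (b - a)⁻¹ * ∫ x in a..b, ∫ y in c..d, f x y|
      ≤ ∫ x in a..b, ∫ y in c..d, |fx x y| := by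
  have hfc : Continuous fun y => ∫ x in a..b, f x y :=
    continuous_integral_right (continuous_uncurry_flip hf) a b
  have habs : Continuous (Function.uncurry fun x y => |fx x y|) := hfx.abs
  rw [integral_integral_comm hf, integral_integral_comm habs,
    ← intervalIntegral.integral_const_mul, ← intervalIntegral.integral_sub
      (Continuous.intervalIntegrable (by fun_prop) _ _)
      (Continuous.intervalIntegrable (by fun_prop) _ _)]
  refine (intervalIntegral.abs_integral_le_integral_abs hcd.le).trans ?_
  refine intervalIntegral.integral_mono_on hcd.le ?_ ?_ fun y _ =>
    abs_sub_average_le (fun x => hdx x y) (by fun_prop) hab hx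
  · exact Continuous.intervalIntegrable (by fun_prop) _ _
  · exact (continuous_integral_right (continuous_uncurry_flip habs) a b).intervalIntegrable _ _

/-- The Poincaré inequality on the unit square. -/
lemma integral_sq_le_of_hasDerivAt (hf : Continuous (Function.uncurry f))
    (hfx : Continuous (Function.uncurry fx)) (hfy : Continuous (Function.uncurry fy))
    (hdx : ∀ x y, HasDerivAt (fun x => f x y) (fx x y) x)
    (hdy : ∀ x y, HasDerivAt (fun y => f x y) (fy x y) y) :
    ∫ x in (0 : ℝ)..1, ∫ y in (0 : ℝ)..1, f x y ^ 2
      ≤ (∫ x in (0 : ℝ)..1, ∫ y in (0 : ℝ)..1, f x y) ^ 2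
        + 2 * (∫ x in (0 : ℝ)..1, ∫ y in (0 : ℝ)..1, fx x y ^ 2)
        + 2 * ∫ x in (0 : ℝ)..1, ∫ y in (0 : ℝ)..1, fy x y ^ 2 := by
  set m := ∫ x in (0 : ℝ)..1, ∫ y in (0 : ℝ)..1, f x y with hm
  set N := ∫ x in (0 : ℝ)..1, ∫ y in (0 : ℝ)..1, |fx x y| with hN
  have hN2 : N ^ 2 ≤ ∫ x in (0 : ℝ)..1, ∫ y in (0 : ℝ)..1, fx x y ^ 2 := by
    have := sq_integral_integral_le (f := fun x y => |fx x y|) hfx.abs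
      (zero_lt_one (α := ℝ)) (zero_lt_one (α := ℝ))
    simpa using this
  have hcy : Continuous (Function.uncurry fun x y => fy x y ^ 2) := hfy.pow 2
  have hcf : Continuous (Function.uncurry fun x y => (f x y - m) ^ 2) :=
    (hf.sub continuous_const).pow 2
  have hcf2 : Continuous (Function.uncurry fun x y => f x y ^ 2) := hf.pow 2
  -- Pass from `f x y` to `m` through the mean over the vertical slice at `x`: the first difference
  -- costs `fy` on that slice, the second costs `N`. The factors 2 come from `(p + q)² ≤ 2p² + 2q²`.
  have hpt : ∀ x ∈ Icc (0 : ℝ) 1, ∀ y ∈ Icc (0 : ℝ) 1,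
      (f x y - m) ^ 2 ≤ 2 * (∫ η in (0 : ℝ)..1, fy x η ^ 2) + 2 * N ^ 2 := by
    intro x hx y hy
    have h1 := abs_sub_average_le (fun y => hdy x y) (by fun_prop) zero_lt_one hy
    have h2 := abs_slice_sub_average_le hf hfx hdx zero_lt_one (zero_lt_one (α := ℝ)) hx
    have h3 := sq_integral_le_mul_integral_sq (f := fun η => |fy x η|) (by fun_prop)
      (zero_lt_one (α := ℝ))
    simp only [sub_zero, inv_one, one_mul, sq_abs] at h1 h2 h3
    have h1' := sq_le_sq' (abs_le.1 h1).1 (abs_le.1 h1).2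
    have h2' := sq_le_sq' (abs_le.1 h2).1 (abs_le.1 h2).2
    nlinarith [sq_nonneg ((f x y - ∫ y in (0:ℝ)..1, f x y) - ((∫ y in (0:ℝ)..1, f x y) - m))]
  have hint : ∫ x in (0 : ℝ)..1, ∫ y in (0 : ℝ)..1, (f x y - m) ^ 2
      ≤ 2 * (∫ x in (0 : ℝ)..1, ∫ y in (0 : ℝ)..1, fy x y ^ 2) + 2 * N ^ 2 := by
    have h1 : ∫ x in (0 : ℝ)..1, ∫ y in (0 : ℝ)..1, (f x y - m) ^ 2
        ≤ ∫ x in (0 : ℝ)..1, (2 * (∫ η in (0 : ℝ)..1, fy x η ^ 2) + 2 * N ^ 2) := by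
      refine intervalIntegral.integral_mono_on zero_le_one ?_ ?_ fun x hx => ?_
      · exact (continuous_integral_right hcf 0 1).intervalIntegrable _ _
      · exact (((continuous_integral_right hcy 0 1).const_mul 2).add_const _).intervalIntegrable _ _
      · have := intervalIntegral.integral_mono_on (μ := volume) (zero_le_one (α := ℝ))
          (Continuous.intervalIntegrable (by fun_prop) _ _)
          (continuous_const.intervalIntegrable _ _) (hpt x hx)
        simpa using this
    refine h1.trans_eq ?_
    rw [intervalIntegral.integral_add
      (((continuous_integral_right hcy 0 1).const_mul 2).intervalIntegrable _ _) (by simp),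
      intervalIntegral.integral_const_mul]
    simp
  have hexp : ∫ x in (0 : ℝ)..1, ∫ y in (0 : ℝ)..1, (f x y - m) ^ 2
      = (∫ x in (0 : ℝ)..1, ∫ y in (0 : ℝ)..1, f x y ^ 2) - m ^ 2 := by
    have h1 : ∀ x, ∫ y in (0 : ℝ)..1, (f x y - m) ^ 2
        = (∫ y in (0 : ℝ)..1, f x y ^ 2) - 2 * m * (∫ y in (0 : ℝ)..1, f x y) + m ^ 2 := by
      intro x
      have : ∀ y, (f x y - m) ^ 2 = f x y ^ 2 - 2 * m * f x y + m ^ 2 := fun y => by ring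
      simp_rw [this]
      rw [intervalIntegral.integral_add, intervalIntegral.integral_sub,
        intervalIntegral.integral_const_mul, intervalIntegral.integral_const]
      · simp
      all_goals exact Continuous.intervalIntegrable (by fun_prop) _ _
    have hc1 := continuous_integral_right hf 0 1
    have hc2 := continuous_integral_right hcf2 0 1
    simp_rw [h1]
    rw [intervalIntegral.integral_add, intervalIntegral.integral_sub,
      intervalIntegral.integral_const_mul, intervalIntegral.integral_const, ← hm]
    · simp; ring
    all_goals exact Continuous.intervalIntegrable (by fun_prop) _ _
  linarith

/-- Substitution `x = u s`: the factor 2 pays for `|u'| ≥ 1/2`, and the constant sign of `u'` keeps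
the image from being covered repeatedly. -/
lemma integral_comp_le_two_mul {M u u' : ℝ → ℝ} (hM : Continuous M) (hM0 : ∀ x, 0 ≤ M x)
    {r p : ℝ} (hr : 0 < r) (hu : ContinuousOn u (Icc 0 r))
    (hud : ∀ s ∈ Ioo 0 r, HasDerivAt u (u' s) s) (hu' : ContinuousOn u' (Icc 0 r))
    (hsgn : (∀ s ∈ Icc 0 r, 1 / 2 ≤ u' s) ∨ (∀ s ∈ Icc 0 r, u' s ≤ -(1 / 2)))
    (hp : ∀ s ∈ Icc 0 r, |u s - p| ≤ r) :
    ∫ s in (0 : ℝ)..r, M (u s) ≤ 2 * ∫ x in (p - r)..(p + r), M x := by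
  have hmem : ∀ s ∈ Icc 0 r, u s ∈ Icc (p - r) (p + r) := fun s hs => by
    have := abs_le.1 (hp s hs)
    constructor <;> linarith
  have hcomp : ContinuousOn (fun s => M (u s)) (Icc 0 r) := hM.comp_continuousOn hu
  have hI1 : IntervalIntegrable (fun s => M (u s)) volume 0 r :=
    ContinuousOn.intervalIntegrable (by rwa [uIcc_of_le hr.le])
  have hI2 : IntervalIntegrable (fun s => M (u s) * u' s) volume 0 r :=
    ContinuousOn.intervalIntegrable (by rw [uIcc_of_le hr.le]; exact hcomp.mul hu')
  have hcv : ∫ s in (0 : ℝ)..r, M (u s) * u' s = ∫ x in (u 0)..(u r), M x := by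
    refine intervalIntegral.integral_comp_mul_deriv''' (f := u) (g := M) ?_ ?_ ?_ ?_ ?_
    · rwa [uIcc_of_le hr.le]
    · intro x hx
      rw [min_eq_left hr.le, max_eq_right hr.le] at hx
      exact (hud x hx).hasDerivWithinAt
    · exact hM.continuousOn
    · rw [uIcc_of_le hr.le]
      exact hM.continuousOn.integrableOn_compact (isCompact_Icc.image_of_continuousOn hu)
    · rw [uIcc_of_le hr.le]
      exact (hcomp.mul hu').integrableOn_compact isCompact_Icc
  have hbd := abs_integral_le_of_mem hM hM0 (hmem 0 (left_mem_Icc.2 hr.le))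
    (hmem r (right_mem_Icc.2 hr.le))
  rw [← hcv] at hbd
  rcases hsgn with h | h
  · have h1 : ∫ s in (0 : ℝ)..r, M (u s) ≤ ∫ s in (0 : ℝ)..r, 2 * (M (u s) * u' s) :=
      intervalIntegral.integral_mono_on hr.le hI1 (hI2.const_mul 2) fun s hs => by
        nlinarith [h s hs, hM0 (u s)]
    rw [intervalIntegral.integral_const_mul] at h1
    linarith [(abs_le.1 hbd).2]
  · have h1 : ∫ s in (0 : ℝ)..r, M (u s) ≤ ∫ s in (0 : ℝ)..r, -2 * (M (u s) * u' s) :=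
      intervalIntegral.integral_mono_on hr.le hI1 (hI2.const_mul (-2)) fun s hs => by
        nlinarith [h s hs, hM0 (u s)]
    rw [intervalIntegral.integral_const_mul] at h1
    linarith [(abs_le.1 hbd).1]

/-- The average of `f` along a short curve issuing from the centre of a square deviates from the
average over the square by a scale invariant multiple of the Dirichlet norm. -/
lemma abs_curve_average_sub_square_average_le (hf : Continuous (Function.uncurry f))
    (hfx : Continuous (Function.uncurry fx)) (hfy : Continuous (Function.uncurry fy))
    (hdx : ∀ x y, HasDerivAt (fun x => f x y) (fx x y) x)
    (hdy : ∀ x y, HasDerivAt (fun y => f x y) (fy x y) y)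
    {u u' w : ℝ → ℝ} {r p q E : ℝ} (hr : 0 < r) (hu : ContinuousOn u (Icc 0 r))
    (hw : ContinuousOn w (Icc 0 r))
    (hud : ∀ s ∈ Ioo 0 r, HasDerivAt u (u' s) s) (hu' : ContinuousOn u' (Icc 0 r))
    (hsgn : (∀ s ∈ Icc 0 r, 1 / 2 ≤ u' s) ∨ (∀ s ∈ Icc 0 r, u' s ≤ -(1 / 2)))
    (hp : ∀ s ∈ Icc 0 r, |u s - p| ≤ r) (hq : ∀ s ∈ Icc 0 r, |w s - q| ≤ r) (hE : 0 ≤ E)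
    (hEx : ∫ x in (p - r)..(p + r), ∫ y in (q - r)..(q + r), fx x y ^ 2 ≤ E ^ 2)
    (hEy : ∫ x in (p - r)..(p + r), ∫ y in (q - r)..(q + r), fy x y ^ 2 ≤ E ^ 2) :
    |r⁻¹ * (∫ s in (0 : ℝ)..r, f (u s) (w s))
      - (2 * r)⁻¹ * ((2 * r)⁻¹ * ∫ x in (p - r)..(p + r), ∫ y in (q - r)..(q + r), f x y)|
      ≤ 5 * E := by
  have hp' : p - r < p + r := by linarith
  have hq' : q - r < q + r := by linarith
  have e1 : p + r - (p - r) = 2 * r := by ring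
  have e2 : q + r - (q - r) = 2 * r := by ring
  -- Cauchy–Schwarz on a square of area `(2r)²`. The factor `2r` gained here cancels the averaging
  -- factors, which makes the final bound independent of `r`.
  have hL1 : ∀ {h : ℝ → ℝ → ℝ}, Continuous (Function.uncurry h) →
      ∫ x in (p - r)..(p + r), ∫ y in (q - r)..(q + r), h x y ^ 2 ≤ E ^ 2 →
      ∫ x in (p - r)..(p + r), ∫ y in (q - r)..(q + r), |h x y| ≤ 2 * r * E := by
    intro h hh hhE
    have := sq_integral_integral_le (f := fun x y => |h x y|) hh.abs hp' hq'
    simp only [sq_abs, e1, e2] at this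
    refine abs_le_of_sq_le_sq' (this.trans ?_) (by positivity) |>.2
    nlinarith [sq_nonneg r]
  set A := ∫ x in (p - r)..(p + r), ∫ y in (q - r)..(q + r), f x y with hA
  set N := ∫ x in (p - r)..(p + r), ∫ y in (q - r)..(q + r), |fx x y| with hN
  have hNE := hL1 hfx hEx
  have hME := hL1 hfy hEy
  have habs : Continuous (Function.uncurry fun x y => |fy x y|) := hfy.abs
  have hM := continuous_integral_right habs (q - r) (q + r)
  have hM0 : ∀ x, 0 ≤ ∫ y in (q - r)..(q + r), |fy x y| := fun x =>
    intervalIntegral.integral_nonneg hq'.le fun _ _ => abs_nonneg _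
  have hcv := integral_comp_le_two_mul hM hM0 hr hu hud hu' hsgn hp
  -- At each point of the curve, compare with the mean over the vertical slice through it (cost
  -- `fy`), then compare the slice mean with the mean over the square (cost `fx`).
  have hpt : ∀ s ∈ Icc 0 r, |f (u s) (w s) - (2 * r)⁻¹ * ((2 * r)⁻¹ * A)|
      ≤ (∫ y in (q - r)..(q + r), |fy (u s) y|) + (2 * r)⁻¹ * N := by
    intro s hs
    have h1 := abs_sub_average_le (fun y => hdy (u s) y) (by fun_prop) hq'
      (x := w s) (by have := abs_le.1 (hq s hs); constructor <;> linarith)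
    have h2 := abs_slice_sub_average_le hf hfx hdx hp' hq'
      (x := u s) (by have := abs_le.1 (hp s hs); constructor <;> linarith)
    rw [e1] at h2
    rw [e2] at h1
    have h3 : |(2 * r)⁻¹ * (∫ y in (q - r)..(q + r), f (u s) y)
        - (2 * r)⁻¹ * ((2 * r)⁻¹ * A)| ≤ (2 * r)⁻¹ * N := by
      rw [← mul_sub, abs_mul, abs_of_pos (by positivity : 0 < (2 * r)⁻¹)]
      exact mul_le_mul_of_nonneg_left h2 (by positivity)
    exact (abs_sub_le _ _ _).trans (add_le_add h1 h3)
  have hcf : ContinuousOn (fun s => f (u s) (w s)) (uIcc 0 r) := by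
    rw [uIcc_of_le hr.le]
    exact hf.comp_continuousOn (hu.prodMk hw)
  have hcM : ContinuousOn (fun s => ∫ y in (q - r)..(q + r), |fy (u s) y|) (uIcc 0 r) := by
    rw [uIcc_of_le hr.le]
    exact hM.comp_continuousOn hu
  have h1 : r⁻¹ * (∫ s in (0 : ℝ)..r, f (u s) (w s)) - (2 * r)⁻¹ * ((2 * r)⁻¹ * A)
      = r⁻¹ * ∫ s in (0 : ℝ)..r, (f (u s) (w s) - (2 * r)⁻¹ * ((2 * r)⁻¹ * A)) := by
    rw [intervalIntegral.integral_sub hcf.intervalIntegrable (by simp)]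
    simp
    field_simp
  rw [h1, abs_mul, abs_of_pos (inv_pos.2 hr), inv_mul_le_iff₀ hr]
  refine (intervalIntegral.abs_integral_le_integral_abs hr.le).trans ?_
  refine (intervalIntegral.integral_mono_on hr.le (hcf.sub continuousOn_const).abs.intervalIntegrable
    (hcM.add continuousOn_const).intervalIntegrable hpt).trans ?_
  simp only [Pi.add_apply]
  rw [intervalIntegral.integral_add hcM.intervalIntegrable (by simp)]
  simp only [intervalIntegral.integral_const, sub_zero, smul_eq_mul]
  -- The constant 5: the `fy` term integrates to at most `2 · 2rE` along the curve, and the `fx`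
  -- term to `N / 2 ≤ rE`.
  have h2 : r * ((2 * r)⁻¹ * N) = N / 2 := by field_simp
  rw [h2]
  linarith

lemma integral_integral_unit_square_of_periodic
    (hx : ∀ x y, f (x + 1) y = f x y) (hy : ∀ x y, f x (y + 1) = f x y) (a b : ℝ) :
    ∫ x in a..(a + 1), ∫ y in b..(b + 1), f x y = ∫ x in (0 : ℝ)..1, ∫ y in (0 : ℝ)..1, f x y := by
  have h1 : ∀ x, ∫ y in b..(b + 1), f x y = ∫ y in (0 : ℝ)..1, f x y := fun x => by
    simpa using Function.Periodic.intervalIntegral_add_eq (f := f x) (T := 1) (hy x) b 0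
  simp_rw [h1]
  have h2 : Function.Periodic (fun x => ∫ y in (0 : ℝ)..1, f x y) 1 := fun x => by
    simp only [hx]
  simpa using h2.intervalIntegral_add_eq a 0

/-- As `2r ≤ 1`, the square lies in the unit cell centred at `(p, q)`, and a periodic function has
the same integral over every unit cell. -/
lemma integral_integral_square_le_of_periodic (hf : Continuous (Function.uncurry f))
    (h0 : ∀ x y, 0 ≤ f x y) (hx : ∀ x y, f (x + 1) y = f x y) (hy : ∀ x y, f x (y + 1) = f x y)
    {r : ℝ} (hr : 0 < r) (hr2 : r ≤ 1 / 2) (p q : ℝ) :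
    ∫ x in (p - r)..(p + r), ∫ y in (q - r)..(q + r), f x y
      ≤ ∫ x in (0 : ℝ)..1, ∫ y in (0 : ℝ)..1, f x y := by
  have hc := fun c d => continuous_integral_right hf c d
  rw [← integral_integral_unit_square_of_periodic hx hy (p - 1 / 2) (q - 1 / 2)]
  have hin : ∀ x, ∫ y in (q - r)..(q + r), f x y
      ≤ ∫ y in (q - 1 / 2)..(q - 1 / 2 + 1), f x y := fun x =>
    intervalIntegral.integral_mono_interval (by linarith) (by linarith) (by linarith)
      (Eventually.of_forall (h0 x)) (Continuous.intervalIntegrable (by fun_prop) _ _)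
  refine (intervalIntegral.integral_mono_on (by linarith) ((hc _ _).intervalIntegrable _ _)
    ((hc _ _).intervalIntegrable _ _) fun x _ => hin x).trans ?_
  exact intervalIntegral.integral_mono_interval (by linarith) (by linarith) (by linarith)
      (Eventually.of_forall fun x => intervalIntegral.integral_nonneg (by linarith)
        fun y _ => h0 x y) ((hc _ _).intervalIntegrable _ _)

end Rectangle

/-! ### Smooth periodic functions on the plane -/

/-- The smooth 1-periodic functions. -/
def IsSmoothPeriodic (φ : Plane → ℝ) : Prop :=
  ContDiff ℝ ∞ φ ∧ ∀ (n : Fin 2 → ℤ) (x : Plane), φ (x + latticeVec n) = φ x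

/-- Lebesgue measure on the unit cell. -/
abbrev cellMeasure : Measure Plane := volume.restrict unitCell

lemma continuous_planePoint : Continuous fun z : ℝ × ℝ => (!₂[z.1, z.2] : Plane) := by
  refine (PiLp.continuous_toLp 2 (fun _ : Fin 2 => ℝ)).comp (continuous_pi fun j => ?_)
  fin_cases j
  · exact continuous_fst
  · exact continuous_snd

lemma planePoint_eta (x : Plane) : (!₂[x 0, x 1] : Plane) = x := by
  ext j; fin_cases j <;> rfl

lemma continuous_uncurry_planePoint {E : Type*} [TopologicalSpace E] {F : Plane → E}
    (hF : Continuous F) :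
    Continuous (Function.uncurry fun x y : ℝ => F (!₂[x, y] : Plane)) :=
  hF.comp continuous_planePoint

lemma measurePreserving_planePoint :
    MeasurePreserving (fun z : ℝ × ℝ => (!₂[z.1, z.2] : Plane)) volume volume := by
  have h1 := (volume_preserving_finTwoArrow ℝ).symm
  have h2 := (EuclideanSpace.volume_preserving_symm_measurableEquiv_toLp (Fin 2)).symm
  exact h2.comp h1

lemma measurableEmbedding_planePoint :
    MeasurableEmbedding (fun z : ℝ × ℝ => (!₂[z.1, z.2] : Plane)) :=
  (MeasurableEquiv.toLp 2 (Fin 2 → ℝ)).measurableEmbedding.comp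
    (MeasurableEquiv.finTwoArrow (α := ℝ)).symm.measurableEmbedding

lemma planePoint_preimage_unitCell :
    (fun z : ℝ × ℝ => (!₂[z.1, z.2] : Plane)) ⁻¹' unitCell = Ioo 0 1 ×ˢ Ioo 0 1 := by
  ext z
  simp [unitCell, Fin.forall_fin_two]

lemma measurableSet_unitCell : MeasurableSet unitCell := by
  have : unitCell = ⋂ j : Fin 2, {x : Plane | 0 < x j ∧ x j < 1} := by
    ext x; simp [unitCell]
  rw [this]
  refine MeasurableSet.iInter fun j => ?_
  have hc : Continuous fun x : Plane => x j := (EuclideanSpace.proj (𝕜 := ℝ) j).continuous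
  exact ((isOpen_lt continuous_const hc).inter (isOpen_lt hc continuous_const)).measurableSet

lemma isBounded_unitCell : Bornology.IsBounded unitCell := by
  refine (Metric.isBounded_closedBall (x := (0 : Plane)) (r := 2)).subset fun x hx => ?_
  rw [mem_closedBall_zero_iff, EuclideanSpace.norm_eq, Fin.sum_univ_two]
  refine Real.sqrt_le_iff.2 ⟨by norm_num, ?_⟩
  have h0 := hx 0
  have h1 := hx 1
  simp only [Real.norm_eq_abs, sq_abs]
  nlinarith

instance isFiniteMeasure_cellMeasure : IsFiniteMeasure cellMeasure :=
  ⟨by simpa using isBounded_unitCell.measure_lt_top⟩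

lemma setIntegral_unitCell {F : Plane → ℝ} (hF : Continuous F) :
    ∫ x in unitCell, F x = ∫ x in (0 : ℝ)..1, ∫ y in (0 : ℝ)..1, F !₂[x, y] := by
  rw [← measurePreserving_planePoint.setIntegral_preimage_emb measurableEmbedding_planePoint,
    planePoint_preimage_unitCell, Measure.volume_eq_prod, setIntegral_prod]
  · rw [intervalIntegral.integral_of_le zero_le_one, integral_Ioc_eq_integral_Ioo]
    refine integral_congr_ae (Eventually.of_forall fun x => ?_)
    simp only
    rw [intervalIntegral.integral_of_le zero_le_one, integral_Ioc_eq_integral_Ioo]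
  · rw [← Measure.volume_eq_prod]
    exact ((hF.comp continuous_planePoint).continuousOn.integrableOn_compact
      (isCompact_Icc.prod isCompact_Icc)).mono_set
        (prod_mono Ioo_subset_Icc_self Ioo_subset_Icc_self)

lemma memLp_cellMeasure_of_continuous {E : Type*} [NormedAddCommGroup E]
    [SecondCountableTopology E] {F : Plane → E} (hF : Continuous F) :
    MemLp F 2 cellMeasure := by
  obtain ⟨C, hC⟩ := (Metric.isCompact_of_isClosed_isBounded isClosed_closure
    isBounded_unitCell.closure).exists_bound_of_continuousOn hF.continuousOn
  refine MemLp.of_bound hF.aestronglyMeasurable C ?_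
  exact (ae_restrict_iff' measurableSet_unitCell).2
    (Eventually.of_forall fun x hx => hC x (subset_closure hx))

lemma hasDerivAt_planePoint {c : ℝ → Plane} {c' : Plane} {t : ℝ}
    (h : ∀ j, HasDerivAt (fun s => c s j) (c' j) t) : HasDerivAt c c' t :=
  (PiLp.continuousLinearEquiv 2 ℝ fun _ : Fin 2 => ℝ).symm.hasFDerivAt.comp_hasDerivAt t
    (hasDerivAt_pi.2 h)

lemma HasDerivAt.planePoint_apply {c : ℝ → Plane} {c' : Plane} {t : ℝ} (h : HasDerivAt c c' t)
    (j : Fin 2) : HasDerivAt (fun s => c s j) (c' j) t :=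
  (EuclideanSpace.proj (𝕜 := ℝ) j).hasFDerivAt.comp_hasDerivAt t h

namespace IsSmoothPeriodic

variable {φ ψ : Plane → ℝ}

lemma continuous (h : IsSmoothPeriodic φ) : Continuous φ := h.1.continuous

lemma differentiable (h : IsSmoothPeriodic φ) : Differentiable ℝ φ :=
  h.1.differentiable (by simp)

lemma continuous_gradient (h : IsSmoothPeriodic φ) : Continuous (gradient φ) :=
  (InnerProductSpace.toDual ℝ Plane).symm.continuous.comp (h.1.continuous_fderiv (by simp))

lemma gradient_add_latticeVec (h : IsSmoothPeriodic φ) (n : Fin 2 → ℤ) (x : Plane) :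
    gradient φ (x + latticeVec n) = gradient φ x := by
  unfold gradient
  have : (fun y => φ (y + latticeVec n)) = φ := funext (h.2 n)
  rw [← fderiv_comp_add_right, this]

lemma hasDerivAt_comp (h : IsSmoothPeriodic φ) {c : ℝ → Plane} {c' : Plane} {t : ℝ}
    (hc : HasDerivAt c c' t) : HasDerivAt (fun t => φ (c t)) (inner ℝ (gradient φ (c t)) c') t := by
  have h1 := (h.differentiable (c t)).hasGradientAt
  exact (hasGradientAt_iff_hasFDerivAt.1 h1).comp_hasDerivAt t hc

lemma hasDerivAt_fst (h : IsSmoothPeriodic φ) (x y : ℝ) :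
    HasDerivAt (fun x => φ !₂[x, y]) (gradient φ !₂[x, y] 0) x := by
  have hc : HasDerivAt (fun x : ℝ => (!₂[x, y] : Plane)) !₂[1, 0] x := by
    refine hasDerivAt_planePoint fun j => ?_
    fin_cases j
    · exact hasDerivAt_id x
    · exact hasDerivAt_const x y
  have h1 := h.hasDerivAt_comp hc
  rw [PiLp.inner_apply, Fin.sum_univ_two] at h1
  simpa using h1

lemma hasDerivAt_snd (h : IsSmoothPeriodic φ) (x y : ℝ) :
    HasDerivAt (fun y => φ !₂[x, y]) (gradient φ !₂[x, y] 1) y := by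
  have hc : HasDerivAt (fun y : ℝ => (!₂[x, y] : Plane)) !₂[0, 1] y := by
    refine hasDerivAt_planePoint fun j => ?_
    fin_cases j
    · exact hasDerivAt_const y x
    · exact hasDerivAt_id y
  have h1 := h.hasDerivAt_comp hc
  rw [PiLp.inner_apply, Fin.sum_univ_two] at h1
  simpa using h1

lemma add (h : IsSmoothPeriodic φ) (h' : IsSmoothPeriodic ψ) :
    IsSmoothPeriodic fun x => φ x + ψ x :=
  ⟨h.1.add h'.1, fun n x => by simp only [h.2, h'.2]⟩

lemma const_mul (h : IsSmoothPeriodic φ) (c : ℝ) : IsSmoothPeriodic fun x => c * φ x :=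
  ⟨contDiff_const.mul h.1, fun n x => by simp only [h.2]⟩

lemma gradient_add (h : IsSmoothPeriodic φ) (h' : IsSmoothPeriodic ψ) (x : Plane) :
    gradient (fun x => φ x + ψ x) x = gradient φ x + gradient ψ x := by
  unfold gradient
  rw [fderiv_fun_add (h.differentiable x) (h'.differentiable x), map_add]

lemma gradient_const_mul (h : IsSmoothPeriodic φ) (c : ℝ) (x : Plane) :
    gradient (fun x => c * φ x) x = c • gradient φ x := by
  unfold gradient
  rw [fderiv_const_mul (h.differentiable x)]
  simp

end IsSmoothPeriodic

lemma isSmoothPeriodic_zero : IsSmoothPeriodic fun _ => 0 :=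
  ⟨contDiff_const, fun _ _ => rfl⟩

lemma planePoint_add_one_left (x y : ℝ) :
    (!₂[x + 1, y] : Plane) = !₂[x, y] + latticeVec ![1, 0] := by
  ext j; fin_cases j <;> simp [latticeVec]

lemma planePoint_add_one_right (x y : ℝ) :
    (!₂[x, y + 1] : Plane) = !₂[x, y] + latticeVec ![0, 1] := by
  ext j; fin_cases j <;> simp [latticeVec]

/-- The Dirichlet integral over the unit cell. -/
def dirichletIntegral (φ : Plane → ℝ) : ℝ := ∫ x in unitCell, ‖gradient φ x‖ ^ 2

lemma dirichletIntegral_nonneg (φ : Plane → ℝ) : 0 ≤ dirichletIntegral φ :=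
  integral_nonneg fun _ => sq_nonneg _

/-- The average of `φ` over the square with centre `p` and side `2r`. -/
def squareAverage (φ : Plane → ℝ) (p : Plane) (r : ℝ) : ℝ :=
  (2 * r)⁻¹ * ((2 * r)⁻¹ *
    ∫ x in (p 0 - r)..(p 0 + r), ∫ y in (p 1 - r)..(p 1 + r), φ !₂[x, y])

/-- Arc ends that agree only modulo the lattice can thus be compared with one and the same square
average. -/
lemma squareAverage_add_latticeVec {φ : Plane → ℝ} (h : IsSmoothPeriodic φ) (p : Plane)
    (n : Fin 2 → ℤ) (r : ℝ) : squareAverage φ (p + latticeVec n) r = squareAverage φ p r := by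
  unfold squareAverage
  have e : ∀ j, (p + latticeVec n) j = p j + n j := fun j => rfl
  have key : ∀ x y : ℝ, φ !₂[x + n 0, y + n 1] = φ !₂[x, y] := fun x y => by
    rw [← h.2 n !₂[x, y]]
    congr 1
    ext j; fin_cases j <;> rfl
  have h1 : ∫ x in (p 0 + n 0 - r)..(p 0 + n 0 + r), ∫ y in (p 1 + n 1 - r)..(p 1 + n 1 + r),
      φ !₂[x, y] = ∫ x in (p 0 - r)..(p 0 + r), ∫ y in (p 1 - r)..(p 1 + r),
      φ !₂[x + n 0, y + n 1] := by
    have e1 : ∀ j, p j + n j - r = p j - r + n j := fun j => by ring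
    have e2 : ∀ j, p j + n j + r = p j + r + n j := fun j => by ring
    rw [e1, e2, e1, e2, ← intervalIntegral.integral_comp_add_right
      (fun x => ∫ y in (p 1 - r + n 1)..(p 1 + r + n 1), φ !₂[x, y])]
    refine intervalIntegral.integral_congr fun x _ => ?_
    exact (intervalIntegral.integral_comp_add_right (fun y => φ !₂[x + n 0, y]) (n 1 : ℝ)).symm
  rw [e, e, h1]
  simp_rw [key]

/-- Cauchy–Schwarz over area `(2r)²`. The constant blows up as `r → 0`, which is harmless because
the bound is used at a single fixed radius. -/
lemma abs_squareAverage_le {φ : Plane → ℝ} (h : IsSmoothPeriodic φ) (p : Plane) {r : ℝ}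
    (hr : 0 < r) (hr2 : r ≤ 1 / 2) :
    |squareAverage φ p r| ≤ (2 * r)⁻¹ * Real.sqrt (∫ x in unitCell, φ x ^ 2) := by
  have hc := continuous_uncurry_planePoint h.continuous
  have h1 := sq_integral_integral_le hc (a := p 0 - r) (b := p 0 + r) (c := p 1 - r)
    (d := p 1 + r) (by linarith) (by linarith)
  have h2 := integral_integral_square_le_of_periodic (f := fun x y => φ !₂[x, y] ^ 2)
    (continuous_uncurry_planePoint (h.continuous.pow 2))
    (fun _ _ => sq_nonneg _) (fun x y => by rw [planePoint_add_one_left, h.2])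
    (fun x y => by rw [planePoint_add_one_right, h.2]) hr hr2 (p 0) (p 1)
  rw [← setIntegral_unitCell (F := fun x => φ x ^ 2) (h.continuous.pow 2)] at h2
  have hB : 0 ≤ ∫ x in unitCell, φ x ^ 2 := integral_nonneg fun _ => sq_nonneg _
  unfold squareAverage
  rw [abs_mul, abs_mul, abs_of_pos (by positivity : 0 < (2 * r)⁻¹)]
  refine mul_le_mul_of_nonneg_left ?_ (by positivity)
  rw [inv_mul_le_iff₀ (by positivity)]
  refine abs_le_of_sq_le_sq ?_ (by positivity)
  rw [mul_pow, Real.sq_sqrt hB]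
  refine h1.trans ?_
  calc _ = (2 * r) ^ 2 * _ := by ring
    _ ≤ _ := mul_le_mul_of_nonneg_left h2 (sq_nonneg _)

lemma integral_sq_le_dirichletIntegral {φ : Plane → ℝ} (h : IsSmoothPeriodic φ) :
    ∫ x in unitCell, φ x ^ 2 ≤ (∫ x in unitCell, φ x) ^ 2 + 2 * dirichletIntegral φ := by
  have hg := h.continuous_gradient
  have hg0 : Continuous fun x => gradient φ x 0 := by fun_prop
  have hg1 : Continuous fun x => gradient φ x 1 := by fun_prop
  have := integral_sq_le_of_hasDerivAt (continuous_uncurry_planePoint h.continuous)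
    (continuous_uncurry_planePoint hg0) (continuous_uncurry_planePoint hg1)
    h.hasDerivAt_fst h.hasDerivAt_snd
  rw [← setIntegral_unitCell h.continuous, ← setIntegral_unitCell (F := fun x => φ x ^ 2) (h.continuous.pow 2),
    ← setIntegral_unitCell (F := fun x => gradient φ x 0 ^ 2) (hg0.pow 2),
    ← setIntegral_unitCell (F := fun x => gradient φ x 1 ^ 2) (hg1.pow 2)] at this
  refine this.trans_eq ?_
  unfold dirichletIntegral
  have h2 : ∀ x, ‖gradient φ x‖ ^ 2 = gradient φ x 0 ^ 2 + gradient φ x 1 ^ 2 := fun x => by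
    rw [EuclideanSpace.norm_sq_eq, Fin.sum_univ_two]; simp
  simp_rw [h2]
  rw [integral_add]
  · ring
  · exact (memLp_cellMeasure_of_continuous hg0).integrable_sq
  · exact (memLp_cellMeasure_of_continuous hg1).integrable_sq

lemma integral_gradient_sq_le {φ : Plane → ℝ} (h : IsSmoothPeriodic φ) (j : Fin 2) (p : Plane)
    {r : ℝ} (hr : 0 < r) (hr2 : r ≤ 1 / 2) :
    ∫ x in (p 0 - r)..(p 0 + r), ∫ y in (p 1 - r)..(p 1 + r), gradient φ !₂[x, y] j ^ 2
      ≤ Real.sqrt (dirichletIntegral φ) ^ 2 := by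
  have hg := h.continuous_gradient
  have hgj : Continuous fun x => gradient φ x j := by fun_prop
  have h2 := integral_integral_square_le_of_periodic (f := fun x y => gradient φ !₂[x, y] j ^ 2)
    (continuous_uncurry_planePoint (hgj.pow 2))
    (fun _ _ => sq_nonneg _)
    (fun x y => by rw [planePoint_add_one_left, h.gradient_add_latticeVec])
    (fun x y => by rw [planePoint_add_one_right, h.gradient_add_latticeVec]) hr hr2 (p 0) (p 1)
  refine h2.trans ?_
  rw [← setIntegral_unitCell (F := fun x => gradient φ x j ^ 2) (hgj.pow 2),
    Real.sq_sqrt (dirichletIntegral_nonneg φ)]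
  refine integral_mono (memLp_cellMeasure_of_continuous hgj).integrable_sq
    (memLp_cellMeasure_of_continuous hg.norm).integrable_sq fun x => ?_
  have := PiLp.norm_apply_le (gradient φ x) j
  simp only
  rw [← sq_abs (gradient φ x j)]
  exact pow_le_pow_left₀ (abs_nonneg _) this 2

/-- Averages along the initial stretches of a unit speed curve are controlled, uniformly in the
length of the stretch, by the averages over squares around the initial point. -/
lemma exists_abs_curve_average_sub_squareAverage_le {η η' : ℝ → Plane} {L : ℝ} (hL : 0 < L)
    (hd : ∀ s ∈ Icc 0 L, HasDerivWithinAt η (η' s) (Icc 0 L) s)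
    (hc : ContinuousOn η' (Icc 0 L)) (hn : ∀ s ∈ Icc 0 L, ‖η' s‖ = 1) :
    ∃ r₀ > 0, r₀ ≤ L ∧ r₀ ≤ 1 / 2 ∧ ∀ r, 0 < r → r ≤ r₀ → ∀ φ, IsSmoothPeriodic φ →
      |r⁻¹ * (∫ s in (0 : ℝ)..r, φ (η s)) - squareAverage φ (η 0) r|
        ≤ 5 * Real.sqrt (dirichletIntegral φ) := by
  have h0 : (0 : ℝ) ∈ Icc 0 L := left_mem_Icc.2 hL.le
  have hdist : ∀ s ∈ Icc 0 L, ‖η s - η 0‖ ≤ s := fun s hs => by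
    have := norm_image_sub_le_of_norm_deriv_le_segment' hd
      (fun x hx => (hn x (Ico_subset_Icc_self hx)).le) s hs
    simpa using this
  have hcoord : ∀ r ≤ L, ∀ j, ∀ s ∈ Icc 0 r, |η s j - η 0 j| ≤ r := fun r hrL j s hs =>
    (PiLp.norm_apply_le (η s - η 0) j).trans ((hdist s ⟨hs.1, hs.2.trans hrL⟩).trans hs.2)
  -- A unit vector of the plane has a component exceeding `1/2` in absolute value; by continuity
  -- this component of the tangent keeps its sign and size near the initial point.
  have hsgn : ∃ j, ∃ δ > 0, ∀ r, 0 < r → r < δ → r ≤ L →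
      (∀ s ∈ Icc 0 r, 1 / 2 ≤ η' s j) ∨ (∀ s ∈ Icc 0 r, η' s j ≤ -(1 / 2)) := by
    have h1 : ∃ j, 1 / 2 < η' 0 j ∨ η' 0 j < -(1 / 2) := by
      by_contra! hcon
      have h2 := EuclideanSpace.norm_sq_eq (η' 0)
      rw [hn 0 h0, Fin.sum_univ_two] at h2
      simp only [Real.norm_eq_abs, sq_abs] at h2
      nlinarith [hcon 0, hcon 1]
    obtain ⟨j, hj⟩ := h1
    have hcj : ContinuousWithinAt (fun s => η' s j) (Icc 0 L) 0 :=
      ((EuclideanSpace.proj (𝕜 := ℝ) j).continuous.comp_continuousOn hc) 0 h0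
    refine ⟨j, ?_⟩
    rcases hj with hj | hj
    · obtain ⟨δ, hδ, hδs⟩ := Metric.mem_nhdsWithin_iff.1 (hcj (Ioi_mem_nhds hj))
      refine ⟨δ, hδ, fun r hr hrδ hrL => Or.inl fun s hs => ?_⟩
      exact le_of_lt (hδs ⟨by
        rw [Metric.mem_ball, Real.dist_eq, sub_zero, abs_of_nonneg hs.1]
        exact hs.2.trans_lt hrδ, hs.1, hs.2.trans hrL⟩)
    · obtain ⟨δ, hδ, hδs⟩ := Metric.mem_nhdsWithin_iff.1 (hcj (Iio_mem_nhds hj))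
      refine ⟨δ, hδ, fun r hr hrδ hrL => Or.inr fun s hs => ?_⟩
      exact le_of_lt (hδs ⟨by
        rw [Metric.mem_ball, Real.dist_eq, sub_zero, abs_of_nonneg hs.1]
        exact hs.2.trans_lt hrδ, hs.1, hs.2.trans hrL⟩)
  obtain ⟨j, δ, hδ, hj⟩ := hsgn
  -- `δ / 2` makes `r < δ` strict, `L` keeps the stretch on the curve, and `1 / 2` lets the square
  -- fit into one period.
  refine ⟨min (δ / 2) (min L (1 / 2)), by positivity, (min_le_right _ _).trans (min_le_left _ _),
    (min_le_right _ _).trans (min_le_right _ _), fun r hr hr0 φ hφ => ?_⟩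
  have hrδ : r < δ := (hr0.trans (min_le_left _ _)).trans_lt (by linarith)
  have hrL : r ≤ L := hr0.trans ((min_le_right _ _).trans (min_le_left _ _))
  have hr2 : r ≤ 1 / 2 := hr0.trans ((min_le_right _ _).trans (min_le_right _ _))
  have hsub : Icc 0 r ⊆ Icc 0 L := Icc_subset_Icc_right hrL
  have hηc : ∀ k, ContinuousOn (fun s => η s k) (Icc 0 r) := fun k =>
    (EuclideanSpace.proj (𝕜 := ℝ) k).continuous.comp_continuousOn
      fun s hs => ((hd s (hsub hs)).continuousWithinAt).mono hsub
  have hη'c : ∀ k, ContinuousOn (fun s => η' s k) (Icc 0 r) := fun k =>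
    (EuclideanSpace.proj (𝕜 := ℝ) k).continuous.comp_continuousOn (hc.mono hsub)
  have hηd : ∀ k, ∀ s ∈ Ioo 0 r, HasDerivAt (fun s => η s k) (η' s k) s := fun k s hs => by
    have h1 := (hd s (hsub (Ioo_subset_Icc_self hs))).hasDerivAt
      (Icc_mem_nhds hs.1 (hs.2.trans_le hrL))
    exact h1.planePoint_apply k
  have hg := hφ.continuous_gradient
  have hgc : ∀ k, Continuous (Function.uncurry fun x y : ℝ => gradient φ !₂[x, y] k) := fun k =>
    continuous_uncurry_planePoint (F := fun x => gradient φ x k) (by fun_prop)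
  have hgc2 : ∀ k, Continuous (Function.uncurry fun x y : ℝ => gradient φ !₂[x, y] k ^ 2) :=
    fun k => (hgc k).pow 2
  have hfc := continuous_uncurry_planePoint hφ.continuous
  have hE := fun k => integral_gradient_sq_le hφ k (η 0) hr hr2
  have hs := hj r hr hrδ hrL
  have hco := hcoord r hrL
  have hEta : ∀ s, φ (η s) = φ !₂[η s 0, η s 1] := fun s => by rw [planePoint_eta]
  simp_rw [hEta]
  unfold squareAverage
  fin_cases j
  · exact abs_curve_average_sub_square_average_le hfc (hgc 0) (hgc 1) hφ.hasDerivAt_fst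
      hφ.hasDerivAt_snd hr (hηc 0) (hηc 1) (hηd 0) (hη'c 0) hs (hco 0) (hco 1)
      (Real.sqrt_nonneg _) (hE 0) (hE 1)
  -- When the second component of the tangent dominates, the coordinates exchange roles, so that the
  -- substitution is made in the coordinate in which the curve advances.
  · rw [integral_integral_comm hfc]
    refine abs_curve_average_sub_square_average_le (f := fun x y => φ !₂[y, x])
      (continuous_uncurry_flip hfc) (continuous_uncurry_flip (hgc 1))
      (continuous_uncurry_flip (hgc 0)) (fun x y => hφ.hasDerivAt_snd y x)
      (fun x y => hφ.hasDerivAt_fst y x) hr (hηc 1) (hηc 0) (hηd 1) (hη'c 1) hs (hco 1) (hco 0)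
      (Real.sqrt_nonneg _) ?_ ?_
    · have := hE 1
      rwa [integral_integral_comm (hgc2 1)] at this
    · have := hE 0
      rwa [integral_integral_comm (hgc2 0)] at this

/-! ### Integration functionals on `L²` of an interval -/

/-- Lebesgue measure on `[0, L]`. -/
abbrev arcMeasure (L : ℝ) : Measure ℝ := volume.restrict (Icc (0 : ℝ) L)

lemma intervalIntegral_eq_setIntegral_arcMeasure {L s t : ℝ} (hs : 0 ≤ s) (hst : s ≤ t)
    (ht : t ≤ L) (f : ℝ → ℝ) : ∫ x in s..t, f x = ∫ x in Ioc s t, f x ∂(arcMeasure L) := by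
  rw [intervalIntegral.integral_of_le hst, Measure.restrict_restrict measurableSet_Ioc,
    inter_eq_left.2 (Ioc_subset_Icc_self.trans (Icc_subset_Icc hs ht))]

/-- The functional `f ↦ ∫_s^t f`. -/
def arcIntegralCLM (L s t : ℝ) : Lp ℝ 2 (arcMeasure L) →L[ℝ] ℝ :=
  innerSL ℝ (indicatorConstLp 2 (measurableSet_Ioc (a := s) (b := t)) (by finiteness) (1 : ℝ))

lemma arcIntegralCLM_apply {L s t : ℝ} (hs : 0 ≤ s) (hst : s ≤ t) (ht : t ≤ L)
    (f : Lp ℝ 2 (arcMeasure L)) : arcIntegralCLM L s t f = ∫ x in s..t, f x := by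
  rw [intervalIntegral_eq_setIntegral_arcMeasure hs hst ht, arcIntegralCLM, innerSL_apply_apply,
    L2.inner_indicatorConstLp_one]

lemma norm_arcIntegralCLM_le {L : ℝ} (hL : 0 ≤ L) (s t : ℝ) :
    ‖arcIntegralCLM L s t‖ ≤ Real.sqrt L := by
  rw [arcIntegralCLM, innerSL_apply_norm, norm_indicatorConstLp (by norm_num) (by norm_num)]
  rw [Real.sqrt_eq_rpow, norm_one, one_mul]
  have h1 : (arcMeasure L).real (Ioc s t) ≤ L := by
    refine (measureReal_mono (subset_univ _) (by finiteness)).trans_eq ?_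
    simp [hL]
  simpa using Real.rpow_le_rpow measureReal_nonneg h1 (by norm_num : (0 : ℝ) ≤ 1 / 2)

lemma abs_integral_coe_le {L t : ℝ} (ht : t ∈ Icc 0 L) (f : Lp ℝ 2 (arcMeasure L)) :
    |∫ x in (0 : ℝ)..t, f x| ≤ Real.sqrt L * ‖f‖ := by
  rw [← arcIntegralCLM_apply le_rfl ht.1 ht.2]
  exact (arcIntegralCLM L 0 t).le_of_opNorm_le (norm_arcIntegralCLM_le (ht.1.trans ht.2) 0 t) f

lemma continuousOn_integral_coe {L : ℝ} (hL : 0 ≤ L) (f : Lp ℝ 2 (arcMeasure L)) :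
    ContinuousOn (fun t => ∫ x in (0 : ℝ)..t, f x) (Icc 0 L) := by
  have h1 : IntegrableOn f (uIcc 0 L) volume := by
    rw [uIcc_of_le hL]
    exact (Lp.memLp f).integrable (by norm_num)
  have := intervalIntegral.continuousOn_primitive_interval h1
  rwa [uIcc_of_le hL] at this

lemma memLp_of_continuousOn {L : ℝ} {u : ℝ → ℝ} (hu : ContinuousOn u (Icc 0 L)) :
    MemLp u 2 (arcMeasure L) := by
  obtain ⟨C, hC⟩ := isCompact_Icc.exists_bound_of_continuousOn hu
  exact MemLp.of_bound (hu.aestronglyMeasurable measurableSet_Icc) C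
    ((ae_restrict_iff' measurableSet_Icc).2 (Eventually.of_forall hC))

/-- The primitive vanishing at the initial point, as an operator on `L²`. -/
def primitiveCLM (L : ℝ) (hL : 0 ≤ L) : Lp ℝ 2 (arcMeasure L) →L[ℝ] Lp ℝ 2 (arcMeasure L) :=
  LinearMap.mkContinuous
    { toFun := fun f => (memLp_of_continuousOn (continuousOn_integral_coe hL f)).toLp _
      map_add' := fun f g => by
        rw [← MemLp.toLp_add]
        refine MemLp.toLp_congr _ _ ?_
        refine (ae_restrict_iff' measurableSet_Icc).2 (Eventually.of_forall fun t ht => ?_)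
        exact TorusPattern.integral_coe_add f g (left_mem_Icc.2 hL) ht
      map_smul' := fun c f => by
        rw [RingHom.id_apply, ← MemLp.toLp_const_smul]
        refine MemLp.toLp_congr _ _ ?_
        refine (ae_restrict_iff' measurableSet_Icc).2 (Eventually.of_forall fun t ht => ?_)
        exact TorusPattern.integral_coe_smul c f (left_mem_Icc.2 hL) ht }
    ((measureUnivNNReal (arcMeasure L) : ℝ) ^ (2 : ℝ≥0∞).toReal⁻¹ * Real.sqrt L)
    fun f => by
      rw [mul_assoc]
      refine Lp.norm_le_of_ae_bound (by positivity) ?_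
      filter_upwards [MemLp.coeFn_toLp (memLp_of_continuousOn (continuousOn_integral_coe hL f)),
        ae_restrict_mem measurableSet_Icc] with t h1 h2
      refine (congrArg norm h1).trans_le ?_
      exact abs_integral_coe_le h2 f

lemma coeFn_primitiveCLM {L : ℝ} (hL : 0 ≤ L) (f : Lp ℝ 2 (arcMeasure L)) :
    primitiveCLM L hL f =ᵐ[arcMeasure L] fun t => ∫ x in (0 : ℝ)..t, f x :=
  MemLp.coeFn_toLp (memLp_of_continuousOn (continuousOn_integral_coe hL f))

lemma L2_norm_sq_eq_integral {α E : Type*} [MeasurableSpace α] {μ : Measure α}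
    [NormedAddCommGroup E] [InnerProductSpace ℝ E] (f : Lp E 2 μ) :
    ‖f‖ ^ 2 = ∫ x, ‖f x‖ ^ 2 ∂μ := by
  rw [← real_inner_self_eq_norm_sq, L2.inner_def]
  simp_rw [real_inner_self_eq_norm_sq]

/-! ### Averages near the ends of an arc -/

namespace TorusPattern

variable {ι : Type*} (P : TorusPattern ι)

/-- The lower end of the stretch of length `r` at the end `e` of the arc `i`. -/
def endLower (i : ι) (e : Bool) (r : ℝ) : ℝ := if e then P.len i - r else 0

/-- The upper end of the stretch of length `r` at the end `e` of the arc `i`. -/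
def endUpper (i : ι) (e : Bool) (r : ℝ) : ℝ := if e then P.len i else r

/-- The parameter at distance `s` from the end `e` of the arc `i`. -/
def fromEnd (i : ι) (e : Bool) (s : ℝ) : ℝ := if e then P.len i - s else s

lemma integral_endLower_endUpper (i : ι) (e : Bool) (r : ℝ) (f : ℝ → ℝ) :
    ∫ t in (P.endLower i e r)..(P.endUpper i e r), f t = ∫ s in (0 : ℝ)..r, f (P.fromEnd i e s) := by
  cases e <;> simp [endLower, endUpper, fromEnd]

lemma endLower_nonneg (i : ι) (e : Bool) {r : ℝ} (hr : r ≤ P.len i) : 0 ≤ P.endLower i e r := by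
  cases e <;> simp [endLower, hr]

lemma endUpper_le (i : ι) (e : Bool) {r : ℝ} (hr : r ≤ P.len i) :
    P.endUpper i e r ≤ P.len i := by
  cases e <;> simp [endUpper, hr]

lemma endLower_le_endUpper (i : ι) (e : Bool) {r : ℝ} (hr : 0 ≤ r) :
    P.endLower i e r ≤ P.endUpper i e r := by
  cases e <;> simp [endLower, endUpper, hr]

lemma fromEnd_mem (i : ι) (e : Bool) {s : ℝ} (hs : s ∈ Icc 0 (P.len i)) :
    P.fromEnd i e s ∈ Icc 0 (P.len i) := by
  cases e
  · simpa [fromEnd] using hs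
  · simpa [fromEnd, and_comm] using hs

lemma continuous_fromEnd (i : ι) (e : Bool) : Continuous (P.fromEnd i e) := by
  cases e
  · exact continuous_id
  · exact continuous_const.sub continuous_id

lemma fromEnd_zero (i : ι) (e : Bool) : P.fromEnd i e 0 = P.endParam i e := by
  cases e <;> simp [fromEnd, endParam]

lemma hasDerivWithinAt_arc (i : ι) {t : ℝ} (ht : t ∈ Icc 0 (P.len i)) :
    HasDerivWithinAt (P.arc i) (P.tangent i t) (Icc 0 (P.len i)) t :=
  ((P.contDiffOn i).differentiableOn (by norm_num) t ht).hasDerivWithinAt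

lemma continuousOn_arc (i : ι) : ContinuousOn (P.arc i) (Icc 0 (P.len i)) :=
  (P.contDiffOn i).continuousOn

/-- The curve estimate for the arc parametrized from its end `e`; at a final end the arc is run
backwards, whence the sign of the tangent. -/
lemma exists_abs_end_average_sub_squareAverage_le (i : ι) (e : Bool) :
    ∃ r₀ > 0, r₀ ≤ P.len i ∧ r₀ ≤ 1 / 2 ∧ ∀ r, 0 < r → r ≤ r₀ → ∀ φ, IsSmoothPeriodic φ →
      |r⁻¹ * (∫ t in (P.endLower i e r)..(P.endUpper i e r), φ (P.arc i t))
        - squareAverage φ (P.endPoint i e) r| ≤ 5 * Real.sqrt (dirichletIntegral φ) := by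
  have h := exists_abs_curve_average_sub_squareAverage_le
    (η := fun s => P.arc i (P.fromEnd i e s))
    (η' := fun s => (if e then (-1 : ℝ) else 1) • P.tangent i (P.fromEnd i e s))
    (P.len_pos i) (fun s hs => ?_) ?_ fun s hs => ?_
  · obtain ⟨r₀, h0, h1, h2, h3⟩ := h
    refine ⟨r₀, h0, h1, h2, fun r hr hr0 φ hφ => ?_⟩
    have := h3 r hr hr0 φ hφ
    rw [P.integral_endLower_endUpper i e r fun t => φ (P.arc i t), endPoint, ← P.fromEnd_zero]
    exact this
  · have h1 : HasDerivWithinAt (P.fromEnd i e) (if e then (-1 : ℝ) else 1)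
        (Icc 0 (P.len i)) s := by
      cases e
      · exact hasDerivWithinAt_id _ _
      · exact ((hasDerivAt_id s).const_sub (P.len i)).hasDerivWithinAt
    exact (P.hasDerivWithinAt_arc i (P.fromEnd_mem i e hs)).scomp s h1
      fun x hx => P.fromEnd_mem i e hx
  · have h1 : ContinuousOn (fun s => P.tangent i (P.fromEnd i e s)) (Icc 0 (P.len i)) :=
      (P.continuousOn_tangent i).comp (P.continuous_fromEnd i e).continuousOn
        fun x hx => P.fromEnd_mem i e hx
    exact h1.const_smul (if e then (-1 : ℝ) else 1)
  · have := P.unit_speed i _ (P.fromEnd_mem i e hs)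
    rw [norm_smul]
    cases e <;> simpa [tangent] using this

/-- The fundamental theorem of calculus at an end point. The function is first extended by constants
beyond the interval, so that the two-sided derivative can be used. -/
lemma tendsto_end_average (i : ι) (e : Bool) {u : ℝ → ℝ} (hu : ContinuousOn u (Icc 0 (P.len i))) :
    Tendsto (fun r => r⁻¹ * ∫ t in (P.endLower i e r)..(P.endUpper i e r), u t) (𝓝[>] 0)
      (𝓝 (u (P.endParam i e))) := by
  have hL := P.len_pos i
  set v := IccExtend hL.le ((Icc 0 (P.len i)).domRestrict fun s => u (P.fromEnd i e s)) with hv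
  have hvc : Continuous v := by
    refine Continuous.Icc_extend' (continuousOn_iff_continuous_domRestrict.1 ?_)
    exact hu.comp (P.continuous_fromEnd i e).continuousOn fun x hx => P.fromEnd_mem i e hx
  have hve : ∀ s ∈ Icc 0 (P.len i), v s = u (P.fromEnd i e s) := fun s hs => by
    rw [hv, IccExtend_of_mem _ _ hs]
    rfl
  have h1 := intervalIntegral.integral_hasDerivAt_right (hvc.intervalIntegrable 0 0)
    (hvc.stronglyMeasurableAtFilter _ _) hvc.continuousAt
  have h2 := (hasDerivAt_iff_tendsto_slope_zero.1 h1).mono_left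
    (nhdsWithin_mono (0 : ℝ) fun x (hx : 0 < x) => hx.ne')
  rw [hve 0 (left_mem_Icc.2 hL.le), P.fromEnd_zero] at h2
  refine h2.congr' ?_
  filter_upwards [Ioc_mem_nhdsGT hL] with r hr
  rw [P.integral_endLower_endUpper]
  simp only [zero_add, intervalIntegral.integral_same, sub_zero, smul_eq_mul]
  congr 1
  refine intervalIntegral.integral_congr fun s hs => ?_
  rw [uIcc_of_le hr.1.le] at hs
  exact hve s ⟨hs.1, hs.2.trans hr.2⟩

end TorusPattern

/-! ### The closure of the smooth functions together with their traces -/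

/-- The integral over the unit cell. -/
def cellMean : Lp ℝ 2 cellMeasure →L[ℝ] ℝ :=
  innerSL ℝ (indicatorConstLp 2 MeasurableSet.univ (by finiteness) (1 : ℝ))

lemma cellMean_apply (v : Lp ℝ 2 cellMeasure) : cellMean v = ∫ x in unitCell, v x := by
  rw [cellMean, innerSL_apply_apply, L2.inner_indicatorConstLp_one, Measure.restrict_univ]

namespace TorusPattern

variable {ι : Type*} [Fintype ι] (P : TorusPattern ι)

/-- Triples (function on the cell, gradient, trace on the arcs). -/
abbrev TraceSpace : Type _ := Lp ℝ 2 cellMeasure × Lp Plane 2 cellMeasure × P.ArcL2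

/-- The triple given by the function `φ`. -/
def IsTraceOf (x : P.TraceSpace) (φ : Plane → ℝ) : Prop :=
  x.1 =ᵐ[cellMeasure] φ ∧ x.2.1 =ᵐ[cellMeasure] gradient φ ∧
    ∀ i, x.2.2 i =ᵐ[arcMeasure (P.len i)] fun t => φ (P.arc i t)

/-- The triples given by smooth periodic functions. -/
def smoothTraces : Submodule ℝ P.TraceSpace where
  carrier := {x | ∃ φ, IsSmoothPeriodic φ ∧ P.IsTraceOf x φ}
  zero_mem' := by
    refine ⟨fun _ => 0, isSmoothPeriodic_zero, Lp.coeFn_zero _ _ _, ?_, fun i => ?_⟩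
    · have h : gradient (fun _ : Plane => (0 : ℝ)) = 0 := by ext1 x; simp [gradient]
      rw [h]
      exact Lp.coeFn_zero _ _ _
    · exact Lp.coeFn_zero ℝ 2 (arcMeasure (P.len i))
  add_mem' := by
    rintro x y ⟨φ, hφ, h1, h2, h3⟩ ⟨ψ, hψ, k1, k2, k3⟩
    refine ⟨fun x => φ x + ψ x, hφ.add hψ, ?_, ?_, fun i => ?_⟩
    · filter_upwards [Lp.coeFn_add x.1 y.1, h1, k1] with t e1 e2 e3
      rw [← e2, ← e3]
      exact e1
    · filter_upwards [Lp.coeFn_add x.2.1 y.2.1, h2, k2] with t e1 e2 e3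
      rw [hφ.gradient_add hψ, ← e2, ← e3]
      exact e1
    · filter_upwards [Lp.coeFn_add (x.2.2 i) (y.2.2 i), h3 i, k3 i] with t e1 e2 e3
      rw [← e2, ← e3]
      exact e1
  smul_mem' := by
    rintro c x ⟨φ, hφ, h1, h2, h3⟩
    refine ⟨fun x => c * φ x, hφ.const_mul c, ?_, ?_, fun i => ?_⟩
    · filter_upwards [Lp.coeFn_smul c x.1, h1] with t e1 e2
      rw [← e2]
      exact e1
    · filter_upwards [Lp.coeFn_smul c x.2.1, h2] with t e1 e2
      rw [hφ.gradient_const_mul, ← e2]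
      exact e1
    · filter_upwards [Lp.coeFn_smul c (x.2.2 i), h3 i] with t e1 e2
      rw [← e2]
      exact e1

variable {P}

/-- The device by which estimates for smooth functions reach `Z`: an inequality between continuous
functions passes to the closure. -/
lemma le_of_mem_closure_smoothTraces {f g : P.TraceSpace → ℝ} (hf : Continuous f)
    (hg : Continuous g) (h : ∀ x φ, IsSmoothPeriodic φ → P.IsTraceOf x φ → f x ≤ g x)
    {x : P.TraceSpace} (hx : x ∈ P.smoothTraces.topologicalClosure) : f x ≤ g x :=
  closure_minimal (s := (P.smoothTraces : Set P.TraceSpace))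
    (fun y ⟨φ, hφ, hy⟩ => h y φ hφ hy) (isClosed_le hf hg) hx

namespace IsTraceOf

variable {x : P.TraceSpace} {φ : Plane → ℝ}

lemma norm_fst (h : P.IsTraceOf x φ) : ‖x.1‖ = Real.sqrt (∫ x in unitCell, φ x ^ 2) := by
  rw [← Real.sqrt_sq (norm_nonneg x.1), L2_norm_sq_eq_integral]
  congr 1
  refine integral_congr_ae (h.1.mono fun t ht => ?_)
  simp [ht]

lemma norm_gradient (h : P.IsTraceOf x φ) : ‖x.2.1‖ = Real.sqrt (dirichletIntegral φ) := by
  rw [← Real.sqrt_sq (norm_nonneg x.2.1), L2_norm_sq_eq_integral]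
  congr 1
  refine integral_congr_ae (h.2.1.mono fun t ht => ?_)
  simp only [ht]

lemma cellMean_fst (h : P.IsTraceOf x φ) : cellMean x.1 = ∫ x in unitCell, φ x := by
  rw [cellMean_apply]
  exact integral_congr_ae h.1

end IsTraceOf

variable (P)

/-- The integral over the stretch of length `r` at the end `e` of the arc `i`. -/
def endIntegral (i : ι) (e : Bool) (r : ℝ) : P.ArcL2 →L[ℝ] ℝ :=
  arcIntegralCLM (P.len i) (P.endLower i e r) (P.endUpper i e r) ∘L
    PiLp.proj 2 (fun i : ι => Lp ℝ 2 (arcMeasure (P.len i))) i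

lemma endIntegral_apply (i : ι) (e : Bool) {r : ℝ} (hr : 0 ≤ r) (hrL : r ≤ P.len i)
    (T : P.ArcL2) {u : ℝ → ℝ} (hu : T i =ᵐ[arcMeasure (P.len i)] u) :
    P.endIntegral i e r T = ∫ t in (P.endLower i e r)..(P.endUpper i e r), u t := by
  have h1 := P.endLower_nonneg i e hrL
  have h2 := P.endLower_le_endUpper i e hr
  have h3 := P.endUpper_le i e hrL
  refine (arcIntegralCLM_apply h1 h2 h3 (T i)).trans ?_
  exact intervalIntegral.integral_congr_ae
    (ae_of_ae_Icc ⟨h1, h2.trans h3⟩ ⟨h1.trans h2, h3⟩ hu)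

/-! ### Estimates on the closure, and matching of traces at nodes -/

variable {P}

/-- The Poincaré inequality. -/
lemma norm_fst_sq_le {x : P.TraceSpace} (hx : x ∈ P.smoothTraces.topologicalClosure) :
    ‖x.1‖ ^ 2 ≤ cellMean x.1 ^ 2 + 2 * ‖x.2.1‖ ^ 2 := by
  refine le_of_mem_closure_smoothTraces (f := fun x : P.TraceSpace => ‖x.1‖ ^ 2)
    (g := fun x : P.TraceSpace => cellMean x.1 ^ 2 + 2 * ‖x.2.1‖ ^ 2) (by fun_prop) (by fun_prop)
    (fun y φ hφ hy => ?_) hx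
  simp only [hy.norm_fst, hy.norm_gradient, hy.cellMean_fst]
  rw [Real.sq_sqrt (integral_nonneg fun _ => sq_nonneg _),
    Real.sq_sqrt (dirichletIntegral_nonneg φ)]
  exact integral_sq_le_dirichletIntegral hφ

/-- At one fixed small `r`, the average of the trace near an end is close to a square average, which
the `L²` norm controls. This later bounds the initial values of traces. -/
lemma exists_abs_endIntegral_le (i : ι) (e : Bool) :
    ∃ r > 0, r ≤ P.len i ∧ ∃ C ≥ 0, ∀ x ∈ P.smoothTraces.topologicalClosure,
      |P.endIntegral i e r x.2.2| ≤ r * (C * (‖x.1‖ + ‖x.2.1‖)) := by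
  obtain ⟨r, hr, hrL, hr2, h⟩ := P.exists_abs_end_average_sub_squareAverage_le i e
  refine ⟨r, hr, hrL, (2 * r)⁻¹ + 5, by positivity, fun x hx => ?_⟩
  refine le_of_mem_closure_smoothTraces (f := fun x : P.TraceSpace => |P.endIntegral i e r x.2.2|)
    (g := fun x : P.TraceSpace => r * (((2 * r)⁻¹ + 5) * (‖x.1‖ + ‖x.2.1‖)))
    (by fun_prop) (by fun_prop) (fun y φ hφ hy => ?_) hx
  have h1 := h r hr le_rfl φ hφ
  have h2 := abs_squareAverage_le hφ (P.endPoint i e) hr hr2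
  rw [P.endIntegral_apply i e hr.le hrL y.2.2 (hy.2.2 i), ← inv_mul_le_iff₀ hr,
    ← abs_of_pos (inv_pos.2 hr), ← abs_mul, hy.norm_fst, hy.norm_gradient]
  have h3 := (abs_sub_abs_le_abs_sub _ _).trans h1
  have h4 : 0 ≤ (2 * r)⁻¹ * Real.sqrt (dirichletIntegral φ) := by positivity
  have h5 : 0 ≤ Real.sqrt (∫ x in unitCell, φ x ^ 2) := by positivity
  linarith

/-- Both averages are within `5 ‖∇‖` of the average over the same square around the common node.
What matters is that 10 does not depend on `r`. -/
lemma exists_abs_endIntegral_sub_le {i : ι} {e : Bool} {j : ι} {e' : Bool} {n : Fin 2 → ℤ}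
    (hn : P.endPoint i e = P.endPoint j e' + latticeVec n) :
    ∃ r₀ > 0, r₀ ≤ P.len i ∧ r₀ ≤ P.len j ∧ ∀ r, 0 < r → r ≤ r₀ →
      ∀ x ∈ P.smoothTraces.topologicalClosure,
        |r⁻¹ * P.endIntegral i e r x.2.2 - r⁻¹ * P.endIntegral j e' r x.2.2|
          ≤ 10 * ‖x.2.1‖ := by
  obtain ⟨r₁, h₁, hL₁, -, hi⟩ := P.exists_abs_end_average_sub_squareAverage_le i e
  obtain ⟨r₂, h₂, hL₂, -, hj⟩ := P.exists_abs_end_average_sub_squareAverage_le j e'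
  refine ⟨min r₁ r₂, lt_min h₁ h₂, (min_le_left _ _).trans hL₁, (min_le_right _ _).trans hL₂,
    fun r hr hr0 x hx => ?_⟩
  have hr1 := hr0.trans (min_le_left _ _)
  have hr2 := hr0.trans (min_le_right _ _)
  refine le_of_mem_closure_smoothTraces
    (f := fun x : P.TraceSpace => |r⁻¹ * P.endIntegral i e r x.2.2
      - r⁻¹ * P.endIntegral j e' r x.2.2|)
    (g := fun x : P.TraceSpace => 10 * ‖x.2.1‖)
    (by fun_prop) (by fun_prop) (fun y φ hφ hy => ?_) hx
  have h1 := hi r hr hr1 φ hφ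
  have h2 := hj r hr hr2 φ hφ
  rw [hn, squareAverage_add_latticeVec hφ] at h1
  rw [P.endIntegral_apply i e hr.le (hr1.trans hL₁) y.2.2 (hy.2.2 i),
    P.endIntegral_apply j e' hr.le (hr2.trans hL₂) y.2.2 (hy.2.2 j), hy.norm_gradient]
  rw [abs_sub_comm] at h2
  have := (abs_sub_le _ _ _).trans (add_le_add h1 h2)
  linarith

/-- The traces on arcs that join at a node of the torus agree there. -/
lemma trace_eq_of_endPoint_eq {x : P.TraceSpace} (hx : x ∈ P.smoothTraces.topologicalClosure)
    {u : ι → ℝ → ℝ} (hu : ∀ i, x.2.2 i =ᵐ[arcMeasure (P.len i)] u i)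
    (huc : ∀ i, ContinuousOn (u i) (Icc 0 (P.len i))) {i : ι} {e : Bool} {j : ι} {e' : Bool}
    {n : Fin 2 → ℤ} (hn : P.endPoint i e = P.endPoint j e' + latticeVec n) :
    u i (P.endParam i e) = u j (P.endParam j e') := by
  obtain ⟨r₀, h0, hLi, hLj, hbd⟩ := exists_abs_endIntegral_sub_le hn
  have hlim : ∀ (y : P.TraceSpace) (v : ι → ℝ → ℝ),
      (∀ i, y.2.2 i =ᵐ[arcMeasure (P.len i)] v i) →
      (∀ i, ContinuousOn (v i) (Icc 0 (P.len i))) →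
      Tendsto (fun r => r⁻¹ * P.endIntegral i e r y.2.2 - r⁻¹ * P.endIntegral j e' r y.2.2)
        (𝓝[>] 0) (𝓝 (v i (P.endParam i e) - v j (P.endParam j e'))) := by
    intro y v hv hvc
    refine ((P.tendsto_end_average i e (hvc i)).sub (P.tendsto_end_average j e' (hvc j))).congr' ?_
    filter_upwards [Ioc_mem_nhdsGT h0] with r hr
    rw [P.endIntegral_apply i e hr.1.le (hr.2.trans hLi) y.2.2 (hv i),
      P.endIntegral_apply j e' hr.1.le (hr.2.trans hLj) y.2.2 (hv j)]
  -- A smooth `y` within `ε` of `x` takes equal values at the two ends, so the averages of `x - y`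
  -- tend to the jump of `x`. The bound `10 ‖∇(x - y)‖ ≤ 10 ε` is uniform in `r` and survives the
  -- limit.
  have hkey : ∀ ε > 0, |u i (P.endParam i e) - u j (P.endParam j e')| ≤ 10 * ε := by
    intro ε hε
    obtain ⟨y, hy, hxy⟩ := Metric.mem_closure_iff.1 hx ε hε
    obtain ⟨φ, hφ, hyφ⟩ := hy
    have hy' : y ∈ P.smoothTraces.topologicalClosure :=
      P.smoothTraces.le_topologicalClosure ⟨φ, hφ, hyφ⟩
    have h1 := hlim x u hu huc
    have h2 := hlim y (fun i t => φ (P.arc i t)) hyφ.2.2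
      (fun i => hφ.continuous.comp_continuousOn (P.continuousOn_arc i))
    have h3 : φ (P.arc i (P.endParam i e)) = φ (P.arc j (P.endParam j e')) :=
      (congrArg φ hn).trans (hφ.2 n _)
    have h4 := (h1.sub h2).abs
    simp only [h3, sub_self, sub_zero] at h4
    refine le_of_tendsto h4 ?_
    filter_upwards [Ioc_mem_nhdsGT h0] with r hr
    have h5 := hbd r hr.1 hr.2 (x - y) (sub_mem hx hy')
    have h6 : (x - y).2.2 = x.2.2 - y.2.2 := rfl
    have h7 : ‖(x - y).2.1‖ ≤ ε :=
      ((norm_fst_le (x - y).2).trans (norm_snd_le (x - y))).trans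
        ((dist_eq_norm x y).symm.trans_le hxy.le)
    rw [h6, map_sub, map_sub] at h5
    refine le_trans (le_of_eq ?_) (h5.trans (by linarith))
    congr 1
    ring
  by_contra hne
  have hpos : 0 < |u i (P.endParam i e) - u j (P.endParam j e')| :=
    abs_pos.2 (sub_ne_zero.2 hne)
  -- With `ε` a twentieth of the jump, the jump would be at most half of itself.
  have := hkey (|u i (P.endParam i e) - u j (P.endParam j e')| / 20) (by positivity)
  linarith

/-! ### The space `Z` as a closed subspace of a Hilbert space -/

variable (P)

/-- Quadruples (function, gradient, arc length derivative of the trace, initial values of the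
trace). -/
abbrev FieldSpace : Type _ :=
  Lp ℝ 2 cellMeasure × Lp Plane 2 cellMeasure × P.ArcL2 × (ι → ℝ)

/-- The trace with given arc length derivative and initial values. -/
def traceCLM : P.ArcL2 × (ι → ℝ) →L[ℝ] P.ArcL2 :=
  ((PiLp.continuousLinearEquiv 2 ℝ fun i : ι => Lp ℝ 2 (arcMeasure (P.len i))).symm :
      (∀ i, Lp ℝ 2 (arcMeasure (P.len i))) →L[ℝ] P.ArcL2) ∘L
    ContinuousLinearMap.pi fun i =>
      Lp.constL 2 (arcMeasure (P.len i)) ℝ ∘L ContinuousLinearMap.proj i ∘L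
          ContinuousLinearMap.snd ℝ P.ArcL2 (ι → ℝ)
        + primitiveCLM (P.len i) (P.len_pos i).le ∘L
          PiLp.proj 2 (fun i : ι => Lp ℝ 2 (arcMeasure (P.len i))) i ∘L
          ContinuousLinearMap.fst ℝ P.ArcL2 (ι → ℝ)

lemma coeFn_traceCLM (q : P.ArcL2 × (ι → ℝ)) (i : ι) :
    P.traceCLM q i =ᵐ[arcMeasure (P.len i)] fun t => q.2 i + ∫ x in (0 : ℝ)..t, q.1 i x := by
  have h1 := Lp.coeFn_const 2 (arcMeasure (P.len i)) (q.2 i)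
  have h2 := coeFn_primitiveCLM (P.len_pos i).le (q.1 i)
  have h3 := Lp.coeFn_add (Lp.const 2 (arcMeasure (P.len i)) (q.2 i))
    (primitiveCLM (P.len i) (P.len_pos i).le (q.1 i))
  filter_upwards [h1, h2, h3] with t e1 e2 e3
  refine e3.trans ?_
  rw [Pi.add_apply, e1, e2]
  rfl

/-- Function, gradient and trace. -/
def toTraceSpace : P.FieldSpace →L[ℝ] P.TraceSpace :=
  (ContinuousLinearMap.id ℝ _).prodMap ((ContinuousLinearMap.id ℝ _).prodMap P.traceCLM)

lemma toTraceSpace_apply (z : P.FieldSpace) :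
    P.toTraceSpace z = (z.1, z.2.1, P.traceCLM z.2.2) := rfl

/-- The space `Z`. -/
def fieldSubmodule : Submodule ℝ P.FieldSpace :=
  P.smoothTraces.topologicalClosure.comap (P.toTraceSpace : P.FieldSpace →ₗ[ℝ] P.TraceSpace) ⊓
    LinearMap.ker ((cellMean ∘L ContinuousLinearMap.fst ℝ _ _ : P.FieldSpace →L[ℝ] ℝ) :
      P.FieldSpace →ₗ[ℝ] ℝ)

lemma mem_fieldSubmodule {z : P.FieldSpace} :
    z ∈ P.fieldSubmodule ↔
      P.toTraceSpace z ∈ P.smoothTraces.topologicalClosure ∧ cellMean z.1 = 0 := Iff.rfl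

lemma isClosed_fieldSubmodule : IsClosed (P.fieldSubmodule : Set P.FieldSpace) := by
  refine IsClosed.inter ?_ ?_
  · exact P.smoothTraces.isClosed_topologicalClosure.preimage P.toTraceSpace.continuous
  · exact isClosed_singleton.preimage
      (cellMean ∘L ContinuousLinearMap.fst ℝ _ _ : P.FieldSpace →L[ℝ] ℝ).continuous

/-- Coercivity on `Z`. The function is controlled by the Poincaré inequality and mean zero; the
initial value of a trace is controlled by the average of the trace near that end, up to the integral
of its derivative. This makes the image of `Z` in the energy space closed. -/
lemma exists_norm_le_of_mem_fieldSubmodule :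
    ∃ C : ℝ, ∀ z ∈ P.fieldSubmodule, ‖z‖ ≤ C * (‖z.2.1‖ + ‖z.2.2.1‖) := by
  choose r hr hrL K hK0 hK using fun i => exists_abs_endIntegral_le (P := P) i false
  have hv : ∀ z ∈ P.fieldSubmodule, ‖z.1‖ ≤ 2 * ‖z.2.1‖ := by
    intro z hz
    obtain ⟨hz1, hz2⟩ := P.mem_fieldSubmodule.1 hz
    have h := norm_fst_sq_le hz1
    rw [P.toTraceSpace_apply] at h
    simp only [hz2] at h
    refine abs_le_of_sq_le_sq' ?_ (by positivity) |>.2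
    nlinarith [sq_nonneg ‖z.2.1‖]
  -- `3 * K i` absorbs `K i * (‖z.1‖ + ‖z.2.1‖)` by means of `‖z.1‖ ≤ 2 * ‖z.2.1‖`; the square root
  -- is the bound for the primitive of the derivative.
  have hc : ∀ z ∈ P.fieldSubmodule, ∀ i,
      |z.2.2.2 i| ≤ (3 * K i + Real.sqrt (P.len i)) * (‖z.2.1‖ + ‖z.2.2.1‖) := by
    intro z hz i
    have h := hK i _ (P.mem_fieldSubmodule.1 hz).1
    rw [P.toTraceSpace_apply] at h
    simp only at h
    have hri := hr i
    have hLi := hrL i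
    have h1 := P.endIntegral_apply i false hri.le hLi (P.traceCLM z.2.2)
      (P.coeFn_traceCLM z.2.2 i)
    have hcont := continuousOn_integral_coe (P.len_pos i).le (z.2.2.1 i)
    have h2 : P.endIntegral i false (r i) (P.traceCLM z.2.2)
        = r i * z.2.2.2 i + ∫ t in (0 : ℝ)..(r i), ∫ x in (0 : ℝ)..t, z.2.2.1 i x := by
      rw [h1]
      simp only [endLower, endUpper, Bool.false_eq_true, if_false]
      rw [intervalIntegral.integral_add (by simp) (ContinuousOn.intervalIntegrable ?_)]
      · simp
      · rw [uIcc_of_le hri.le]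
        exact hcont.mono (Icc_subset_Icc_right hLi)
    have h3 : |∫ t in (0 : ℝ)..(r i), ∫ x in (0 : ℝ)..t, z.2.2.1 i x|
        ≤ r i * (Real.sqrt (P.len i) * ‖z.2.2.1‖) := by
      have := intervalIntegral.norm_integral_le_of_norm_le_const (a := 0) (b := r i)
        (f := fun t => ∫ x in (0 : ℝ)..t, z.2.2.1 i x)
        (C := Real.sqrt (P.len i) * ‖z.2.2.1‖) fun t ht => by
          rw [uIoc_of_le hri.le] at ht
          exact (abs_integral_coe_le ⟨ht.1.le, ht.2.trans hLi⟩ (z.2.2.1 i)).trans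
            (mul_le_mul_of_nonneg_left (PiLp.norm_apply_le z.2.2.1 i) (Real.sqrt_nonneg _))
      rw [sub_zero, abs_of_pos hri, mul_comm] at this
      exact this
    have h4 : |r i * z.2.2.2 i| ≤ r i * (K i * (‖z.1‖ + ‖z.2.1‖))
        + r i * (Real.sqrt (P.len i) * ‖z.2.2.1‖) := by
      rw [h2] at h
      have h5 := abs_sub (r i * z.2.2.2 i + ∫ t in (0 : ℝ)..(r i), ∫ x in (0 : ℝ)..t, z.2.2.1 i x)
        (∫ t in (0 : ℝ)..(r i), ∫ x in (0 : ℝ)..t, z.2.2.1 i x)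
      rw [add_sub_cancel_right] at h5
      exact h5.trans (add_le_add h h3)
    rw [abs_mul, abs_of_pos hri, ← mul_add] at h4
    have h6 := le_of_mul_le_mul_left h4 hri
    have h7 := mul_le_mul_of_nonneg_left (hv z hz) (hK0 i)
    have h8 := mul_nonneg (hK0 i) (norm_nonneg z.2.2.1)
    have h9 := mul_nonneg (Real.sqrt_nonneg (P.len i)) (norm_nonneg z.2.1)
    nlinarith
  refine ⟨2 + ∑ i, (3 * K i + Real.sqrt (P.len i)), fun z hz => ?_⟩
  set N := ‖z.2.1‖ + ‖z.2.2.1‖ with hN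
  have hN1 : ‖z.2.1‖ ≤ N := le_add_of_nonneg_right (norm_nonneg _)
  have hN2 : ‖z.2.2.1‖ ≤ N := le_add_of_nonneg_left (norm_nonneg _)
  have hN0 : 0 ≤ N := (norm_nonneg _).trans hN1
  have hKs : ∀ i, 0 ≤ 3 * K i + Real.sqrt (P.len i) := fun i => by
    have := hK0 i
    positivity
  have hS : 0 ≤ ∑ i, (3 * K i + Real.sqrt (P.len i)) := Finset.sum_nonneg fun i _ => hKs i
  have hSN := mul_nonneg hS hN0
  have hcN : ‖z.2.2.2‖ ≤ (∑ i, (3 * K i + Real.sqrt (P.len i))) * N :=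
    (pi_norm_le_iff_of_nonneg hSN).2 fun i => (hc z hz i).trans
      (mul_le_mul_of_nonneg_right
        (Finset.single_le_sum (f := fun i => 3 * K i + Real.sqrt (P.len i))
          (fun i _ => hKs i) (Finset.mem_univ i)) hN0)
  have hvz := hv z hz
  rw [add_mul]
  refine norm_prod_le_iff.2 ⟨by linarith, norm_prod_le_iff.2 ⟨by linarith,
    norm_prod_le_iff.2 ⟨by linarith, by linarith⟩⟩⟩

end TorusPattern

namespace TorusPattern

variable {ι : Type*} [Fintype ι] (P : TorusPattern ι)

/-! ### Derivatives of periodic functions on the pattern -/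

/-- The arc length derivatives of the functions in `𝓜¹_per(Γ₁)`. -/
def perDerivs : Submodule ℝ P.ArcL2 :=
  P.perSpace.map (WithLp.sndₗ 2 ℝ P.ArcL2 P.ArcL2)

/-- The function on the arcs with derivative `q.1` and initial values `q.2`. -/
def primitive (q : P.ArcL2 × (ι → ℝ)) (i : ι) (t : ℝ) : ℝ := q.2 i + ∫ x in (0 : ℝ)..t, q.1 i x

lemma primitive_sub_primitive (q : P.ArcL2 × (ι → ℝ)) (i : ι) {s t : ℝ}
    (hs : s ∈ Icc 0 (P.len i)) (ht : t ∈ Icc 0 (P.len i)) :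
    P.primitive q i t - P.primitive q i s = ∫ x in s..t, q.1 i x := by
  have h0 : (0 : ℝ) ∈ Icc 0 (P.len i) := left_mem_Icc.2 (P.len_pos i).le
  rw [← intervalIntegral.integral_interval_sub_left (intervalIntegrable_coe (q.1 i) h0 ht)
    (intervalIntegrable_coe (q.1 i) h0 hs)]
  simp [primitive]

lemma continuousOn_primitive (q : P.ArcL2 × (ι → ℝ)) (i : ι) :
    ContinuousOn (P.primitive q i) (Icc 0 (P.len i)) :=
  continuousOn_const.add (continuousOn_integral_coe (P.len_pos i).le (q.1 i))

/-- Any `L²` derivative with any initial values integrates to a function on the arcs, so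
single-valuedness at the nodes is the only condition. -/
lemma mem_perDerivs_of_match (q : P.ArcL2 × (ι → ℝ))
    (h : ∀ i e j e', ∀ n : Fin 2 → ℤ, P.endPoint i e = P.endPoint j e' + latticeVec n →
      P.primitive q i (P.endParam i e) = P.primitive q j (P.endParam j e')) :
    q.1 ∈ P.perDerivs :=
  ⟨WithLp.toLp 2 (P.traceCLM q, q.1), ⟨P.primitive q, fun i => P.coeFn_traceCLM q i,
    fun i _ hs _ ht => P.primitive_sub_primitive q i hs ht, h⟩, rfl⟩

/-- The link between the cell problem and the graph, and the source of the lower bound for the trace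
of the tensor. -/
lemma snd_mem_perDerivs_of_mem_fieldSubmodule {z : P.FieldSpace} (hz : z ∈ P.fieldSubmodule) :
    z.2.2.1 ∈ P.perDerivs :=
  P.mem_perDerivs_of_match z.2.2 fun _ _ _ _ _ hn =>
    trace_eq_of_endPoint_eq (P.mem_fieldSubmodule.1 hz).1 (u := P.primitive z.2.2)
      (fun i => P.coeFn_traceCLM z.2.2 i) (P.continuousOn_primitive z.2.2) hn

/-! ### The energy space -/

/-- Pairs (gradient, arc length derivative of the trace). -/
abbrev EnergySpace : Type _ := WithLp 2 (Lp Plane 2 cellMeasure × P.ArcL2)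

/-- The gradient and the derivative of the trace, weighted by `√a`. -/
def energyMap (a : ℝ) : P.FieldSpace →L[ℝ] P.EnergySpace :=
  ((WithLp.prodContinuousLinearEquiv 2 ℝ (Lp Plane 2 cellMeasure) P.ArcL2).symm :
      (Lp Plane 2 cellMeasure × P.ArcL2) →L[ℝ] P.EnergySpace) ∘L
    ((ContinuousLinearMap.id ℝ _).prodMap
      (Real.sqrt a • ContinuousLinearMap.fst ℝ P.ArcL2 (ι → ℝ))) ∘L
    ContinuousLinearMap.snd ℝ (Lp ℝ 2 cellMeasure) (Lp Plane 2 cellMeasure × P.ArcL2 × (ι → ℝ))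

lemma energyMap_apply (a : ℝ) (z : P.FieldSpace) :
    P.energyMap a z = WithLp.toLp 2 (z.2.1, Real.sqrt a • z.2.2.1) := rfl

/-- The image of `Z` in the energy space. -/
def energySubmodule (a : ℝ) : Submodule ℝ P.EnergySpace :=
  P.fieldSubmodule.map (P.energyMap a : P.FieldSpace →ₗ[ℝ] P.EnergySpace)

/-- By coercivity the energy map is bounded below on the complete space `Z`, so its range is closed
and orthogonal projection onto it exists. Positivity of `a` is needed to recover the trace
derivative from its multiple by `√a`. -/
lemma isClosed_energySubmodule {a : ℝ} (ha : 0 < a) :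
    IsClosed (P.energySubmodule a : Set P.EnergySpace) := by
  obtain ⟨C, hC⟩ := P.exists_norm_le_of_mem_fieldSubmodule
  have hs : 0 < Real.sqrt a := Real.sqrt_pos.2 ha
  set f : P.fieldSubmodule →L[ℝ] P.EnergySpace := P.energyMap a ∘L P.fieldSubmodule.subtypeL
    with hf
  have hbd : ∀ z : P.fieldSubmodule,
      ‖z‖ ≤ (Real.toNNReal (|C| * (1 + (Real.sqrt a)⁻¹)) : ℝ) * ‖f z‖ := by
    rintro ⟨z, hz⟩
    rw [Real.coe_toNNReal _ (by positivity)]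
    have h1 : ‖z.2.1‖ ≤ ‖P.energyMap a z‖ := WithLp.norm_fst_le (p := 2) _ (P.energyMap a z)
    have h2 : ‖Real.sqrt a • z.2.2.1‖ ≤ ‖P.energyMap a z‖ :=
      WithLp.norm_snd_le (p := 2) _ (P.energyMap a z)
    rw [norm_smul, Real.norm_eq_abs, abs_of_pos hs, ← le_inv_mul_iff₀ hs] at h2
    calc ‖z‖ ≤ C * (‖z.2.1‖ + ‖z.2.2.1‖) := hC z hz
      _ ≤ |C| * (‖z.2.1‖ + ‖z.2.2.1‖) :=
        mul_le_mul_of_nonneg_right (le_abs_self C) (by positivity)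
      _ ≤ |C| * (‖P.energyMap a z‖ + (Real.sqrt a)⁻¹ * ‖P.energyMap a z‖) :=
        mul_le_mul_of_nonneg_left (add_le_add h1 h2) (abs_nonneg C)
      _ = _ := by rw [hf]; simp only [ContinuousLinearMap.comp_apply, Submodule.subtypeL_apply]; ring
  have : CompleteSpace P.fieldSubmodule :=
    (P.isClosed_fieldSubmodule.isComplete).completeSpace_coe
  have h1 := (AddMonoidHomClass.antilipschitz_of_bound f hbd).isClosed_range f.uniformContinuous
  have h2 : (P.energySubmodule a : Set P.EnergySpace) = range f := by
    refine Set.ext fun y => ⟨?_, ?_⟩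
    · rintro ⟨z, hz, rfl⟩
      exact ⟨⟨z, hz⟩, rfl⟩
    · rintro ⟨⟨z, hz⟩, rfl⟩
      exact ⟨z, hz, rfl⟩
  rwa [h2]

/-! ### Elements of `Z` as cell fields -/

variable {P} in
/-- The element of the Hilbert space given by a cell field. -/
def MemZ.toField {w : CellField ι} (h : P.MemZ w) : P.FieldSpace :=
  (h.val_memLp.toLp _, h.grad_memLp.toLp _,
    WithLp.toLp 2 fun i => (h.traceDeriv_memLp i).toLp _, fun i => w.trace i 0)

variable {P} in
lemma MemZ.coeFn_toField {w : CellField ι} (h : P.MemZ w) (i : ι) :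
    h.toField.2.2.1 i =ᵐ[arcMeasure (P.len i)] w.traceDeriv i :=
  MemLp.coeFn_toLp (h.traceDeriv_memLp i)

variable {P} in
lemma MemZ.traceCLM_toField {w : CellField ι} (h : P.MemZ w) :
    P.traceCLM h.toField.2.2 = WithLp.toLp 2 fun i => (h.trace_memLp i).toLp _ := by
  ext1 i
  refine Lp.ext ?_
  refine (P.coeFn_traceCLM _ i).trans (EventuallyEq.trans ?_ (MemLp.coeFn_toLp (h.trace_memLp i)).symm)
  refine (ae_restrict_iff' measurableSet_Icc).2 (Eventually.of_forall fun t ht => ?_)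
  have h0 : (0 : ℝ) ∈ Icc 0 (P.len i) := left_mem_Icc.2 (P.len_pos i).le
  have h1 := h.trace_eq i 0 h0 t ht
  have h2 : ∫ x in (0 : ℝ)..t, h.toField.2.2.1 i x = ∫ x in (0 : ℝ)..t, w.traceDeriv i x :=
    intervalIntegral.integral_congr_ae (ae_of_ae_Icc h0 ht (h.coeFn_toField i))
  have h3 : h.toField.2.2.2 i = w.trace i 0 := rfl
  simp only [h2, h3, ← h1]
  ring

variable {P} in
lemma MemZ.toField_mem {w : CellField ι} (h : P.MemZ w) : h.toField ∈ P.fieldSubmodule := by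
  rw [P.mem_fieldSubmodule]
  constructor
  · obtain ⟨φ, hφ1, hφ2, h1, h2, h3⟩ := h.approx
    have hφ : ∀ m, IsSmoothPeriodic (φ m) := fun m => ⟨hφ1 m, hφ2 m⟩
    have hm1 := fun m => memLp_cellMeasure_of_continuous (hφ m).continuous
    have hm2 := fun m => memLp_cellMeasure_of_continuous (hφ m).continuous_gradient
    have hm3 := fun i m => memLp_of_continuousOn (L := P.len i)
      ((hφ m).continuous.comp_continuousOn (P.continuousOn_arc i))
    rw [P.toTraceSpace_apply, h.traceCLM_toField]
    have hx : Tendsto (fun m => (((hm1 m).toLp _, (hm2 m).toLp _,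
        WithLp.toLp 2 fun i => (hm3 i m).toLp _) : P.TraceSpace)) atTop
        (𝓝 (h.val_memLp.toLp _, h.grad_memLp.toLp _,
          WithLp.toLp 2 fun i => (h.trace_memLp i).toLp _)) := by
      refine Tendsto.prodMk_nhds ?_ (Tendsto.prodMk_nhds ?_ ?_)
      · exact (Lp.tendsto_Lp_iff_tendsto_eLpNorm'' _ hm1 _ h.val_memLp).2 h1
      · exact (Lp.tendsto_Lp_iff_tendsto_eLpNorm'' _ hm2 _ h.grad_memLp).2 h2
      · refine ((PiLp.continuous_toLp 2 _).tendsto _).comp (tendsto_pi_nhds.2 fun i => ?_)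
        exact (Lp.tendsto_Lp_iff_tendsto_eLpNorm'' _ (hm3 i) _ (h.trace_memLp i)).2 (h3 i)
    refine mem_closure_of_tendsto hx (Eventually.of_forall fun m => ⟨φ m, hφ m, ?_, ?_, fun i => ?_⟩)
    · exact MemLp.coeFn_toLp (hm1 m)
    · exact MemLp.coeFn_toLp (hm2 m)
    · exact MemLp.coeFn_toLp (hm3 i m)
  · rw [cellMean_apply, ← h.mean_zero]
    exact integral_congr_ae (MemLp.coeFn_toLp h.val_memLp)

/-- The cell field given by an element of the Hilbert space. -/
def toCellField (z : P.FieldSpace) : CellField ι where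
  val := z.1
  grad := z.2.1
  trace := P.primitive z.2.2
  traceDeriv i := z.2.2.1 i

lemma memZ_toCellField {z : P.FieldSpace} (hz : z ∈ P.fieldSubmodule) :
    P.MemZ (P.toCellField z) where
  val_memLp := Lp.memLp z.1
  grad_memLp := Lp.memLp z.2.1
  trace_memLp i := memLp_of_continuousOn (P.continuousOn_primitive z.2.2 i)
  traceDeriv_memLp i := Lp.memLp (z.2.2.1 i)
  approx := by
    obtain ⟨x, hx, hlim⟩ := mem_closure_iff_seq_limit.1 (P.mem_fieldSubmodule.1 hz).1
    choose φ hφ h1 h2 h3 using hx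
    rw [P.toTraceSpace_apply] at hlim
    have l1 := (continuous_fst.tendsto _).comp hlim
    have l2 := ((continuous_fst.comp continuous_snd).tendsto _).comp hlim
    have l3 := fun i => (((PiLp.proj (𝕜 := ℝ) 2 (fun i : ι => Lp ℝ 2 (arcMeasure (P.len i))) i
      ).continuous.comp (continuous_snd.comp continuous_snd)).tendsto _).comp hlim
    refine ⟨φ, fun m => (hφ m).1, fun m => (hφ m).2, ?_, ?_, fun i => ?_⟩
    · refine ((Lp.tendsto_Lp_iff_tendsto_eLpNorm' _ _).1 l1).congr fun m => eLpNorm_congr_ae ?_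
      filter_upwards [h1 m] with t ht
      exact congrArg (· - z.1 t) ht
    · refine ((Lp.tendsto_Lp_iff_tendsto_eLpNorm' _ _).1 l2).congr fun m => eLpNorm_congr_ae ?_
      filter_upwards [h2 m] with t ht
      exact congrArg (· - z.2.1 t) ht
    · refine ((Lp.tendsto_Lp_iff_tendsto_eLpNorm' _ _).1 (l3 i)).congr
        fun m => eLpNorm_congr_ae ?_
      filter_upwards [h3 m i, P.coeFn_traceCLM z.2.2 i] with t ht ht2
      exact congrArg₂ (· - ·) ht ht2
  trace_eq i s hs t ht := P.primitive_sub_primitive z.2.2 i hs ht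
  mean_zero := by
    have := (P.mem_fieldSubmodule.1 hz).2
    rwa [cellMean_apply] at this

/-- Every element of the Hilbert space model thus occurs as a test function in the corrector
equation. -/
lemma toField_toCellField {z : P.FieldSpace} (hz : z ∈ P.fieldSubmodule) :
    (P.memZ_toCellField hz).toField = z := by
  refine Prod.ext ?_ (Prod.ext ?_ (Prod.ext ?_ ?_))
  · exact Lp.toLp_coeFn z.1 (Lp.memLp z.1)
  · exact Lp.toLp_coeFn z.2.1 (Lp.memLp z.2.1)
  · ext1 i
    exact Lp.toLp_coeFn (z.2.2.1 i) (Lp.memLp (z.2.2.1 i))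
  · funext i
    change z.2.2.2 i + ∫ x in (0 : ℝ)..0, z.2.2.1 i x = z.2.2.2 i
    simp

/-! ### Correctors as orthogonal projections -/

/-- The derivatives `(x_k)_s` of the coordinate function. -/
def tangentL2 (k : Fin 2) : P.ArcL2 := WithLp.toLp 2 fun i => (P.memLp_tangent k i).toLp _

lemma coeFn_tangentL2 (k : Fin 2) (i : ι) :
    P.tangentL2 k i =ᵐ[arcMeasure (P.len i)] fun t => P.tangent i t k :=
  MemLp.coeFn_toLp (P.memLp_tangent k i)

/-- The right hand side of the corrector problem in the energy space. -/
def energySource (a : ℝ) (k : Fin 2) : P.EnergySpace :=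
  WithLp.toLp 2 (0, Real.sqrt a • P.tangentL2 k)

lemma inner_arcL2 {f g : P.ArcL2} {u v : ι → ℝ → ℝ}
    (hf : ∀ i, f i =ᵐ[arcMeasure (P.len i)] u i) (hg : ∀ i, g i =ᵐ[arcMeasure (P.len i)] v i) :
    inner ℝ f g = ∑ i, ∫ t in (0 : ℝ)..P.len i, u i t * v i t := by
  rw [PiLp.inner_apply]
  refine Finset.sum_congr rfl fun i _ => ?_
  rw [L2.inner_def, intervalIntegral.integral_of_le (P.len_pos i).le, ← integral_Icc_eq_integral_Ioc]
  refine integral_congr_ae ?_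
  filter_upwards [hf i, hg i] with t h1 h2
  rw [h1, h2]
  simp [mul_comm]

lemma inner_energySpace {a : ℝ} (ha : 0 ≤ a) (G G' : Lp Plane 2 cellMeasure) (g g' : P.ArcL2) :
    inner ℝ (WithLp.toLp 2 (G, Real.sqrt a • g) : P.EnergySpace)
      (WithLp.toLp 2 (G', Real.sqrt a • g')) = inner ℝ G G' + a * inner ℝ g g' := by
  rw [WithLp.prod_inner_apply]
  simp only [real_inner_smul_left, real_inner_smul_right]
  rw [← mul_assoc, Real.mul_self_sqrt ha]

variable {P} in
-- The weight `√a` is chosen so that the weak form becomes a single inner product; the corrector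
-- equation is then an orthogonality relation.
lemma MemZ.inner_toField {a : ℝ} (ha : 0 ≤ a) (k : Fin 2) {v w : CellField ι} (hv : P.MemZ v)
    (hw : P.MemZ w) :
    inner ℝ (P.energyMap a hv.toField) (P.energyMap a hw.toField + P.energySource a k)
      = (∫ x in unitCell, inner ℝ (v.grad x) (w.grad x))
      + a * (∑ i, ∫ t in (0 : ℝ)..P.len i, v.traceDeriv i t * w.traceDeriv i t)
      + a * (∑ i, ∫ t in (0 : ℝ)..P.len i, v.traceDeriv i t * P.tangent i t k) := by
  rw [inner_add_right, P.energyMap_apply, P.energyMap_apply, energySource,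
    P.inner_energySpace ha, P.inner_energySpace ha, inner_zero_right, zero_add,
    P.inner_arcL2 hv.coeFn_toField hw.coeFn_toField,
    P.inner_arcL2 hv.coeFn_toField (P.coeFn_tangentL2 k), L2.inner_def]
  congr 2
  refine integral_congr_ae ?_
  filter_upwards [MemLp.coeFn_toLp hv.grad_memLp, MemLp.coeFn_toLp hw.grad_memLp] with x h1 h2
  exact congrArg₂ (fun p q : Plane => inner ℝ p q) h1 h2

/-- The weak equation makes source plus image of `w` orthogonal to the image of `Z`, which
characterizes minus the image of `w` as the projection of the source. -/
lemma isCorrector_iff {a : ℝ} (ha : 0 ≤ a) [(P.energySubmodule a).HasOrthogonalProjection]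
    (k : Fin 2) (w : CellField ι) :
    P.IsCorrector a k w ↔ ∃ h : P.MemZ w,
      (P.energySubmodule a).starProjection (P.energySource a k) = -P.energyMap a h.toField := by
  constructor
  · rintro ⟨h, hw⟩
    refine ⟨h, Submodule.eq_starProjection_of_mem_of_inner_eq_zero
      (neg_mem ⟨_, h.toField_mem, rfl⟩) ?_⟩
    rintro _ ⟨z, hz, rfl⟩
    have := hw _ (P.memZ_toCellField hz)
    rw [← (P.memZ_toCellField hz).inner_toField ha k h, P.toField_toCellField hz, real_inner_comm] at this
    rw [sub_neg_eq_add, add_comm]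
    exact this
  · rintro ⟨h, hw⟩
    refine ⟨h, fun v hv => ?_⟩
    rw [← hv.inner_toField ha k h, real_inner_comm]
    have := Submodule.starProjection_inner_eq_zero (K := P.energySubmodule a)
      (P.energySource a k) (P.energyMap a hv.toField) ⟨_, hv.toField_mem, rfl⟩
    rwa [hw, sub_neg_eq_add, add_comm] at this

end TorusPattern

/-! ### Subintervals -/

lemma exists_Icc_subset_of_eventually {s t x₀ : ℝ} (hst : s < t) (hx : x₀ ∈ Icc s t)
    {p : ℝ → Prop} (h : ∀ᶠ x in 𝓝[Icc s t] x₀, p x) :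
    ∃ s' t', s' < t' ∧ Icc s' t' ⊆ Icc s t ∧ ∀ x ∈ Icc s' t', p x := by
  obtain ⟨ε, hε, hsub⟩ := Metric.mem_nhdsWithin_iff.1 h
  have hx1 := hx.1
  have hx2 := hx.2
  refine ⟨max s (x₀ - ε / 2), min t (x₀ + ε / 2), ?_, Icc_subset_Icc (le_max_left _ _)
    (min_le_left _ _), fun x hx' => hsub ⟨?_, ?_⟩⟩
  · refine max_lt (lt_min hst ?_) (lt_min ?_ ?_) <;> linarith
  · have h1 := (le_max_right _ _).trans hx'.1
    have h2 := hx'.2.trans (min_le_right _ _)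
    rw [Metric.mem_ball, Real.dist_eq, abs_lt]
    constructor <;> linarith
  · exact ⟨(le_max_left _ _).trans hx'.1, hx'.2.trans (min_le_left _ _)⟩

/-- Either `f` is integer valued on the whole interval, hence locally constant, or it takes a
non-integer value, around which the floor does not jump. -/
lemma exists_Icc_subset_floor_eq {f : ℝ → ℝ} {s t : ℝ} (hst : s < t)
    (hf : ContinuousOn f (Icc s t)) :
    ∃ s' t', s' < t' ∧ Icc s' t' ⊆ Icc s t ∧ ∃ m : ℤ, ∀ x ∈ Icc s' t', ⌊f x⌋ = m := by
  by_cases hint : ∀ x ∈ Icc s t, f x = ⌊f x⌋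
  · have hs : s ∈ Icc s t := left_mem_Icc.2 hst.le
    have h1 : ∀ᶠ x in 𝓝[Icc s t] s, |f x - f s| < 1 := by
      have := (hf s hs).eventually (Metric.ball_mem_nhds (f s) one_pos)
      simpa [Real.dist_eq] using this
    have h2 : ∀ᶠ x in 𝓝[Icc s t] s, ⌊f x⌋ = ⌊f s⌋ := by
      filter_upwards [h1, self_mem_nhdsWithin] with x hx hmem
      rw [hint x hmem, hint s hs, ← Int.cast_sub, ← Int.cast_abs, ← Int.cast_one,
        Int.cast_lt, Int.abs_lt_one_iff] at hx
      exact sub_eq_zero.1 hx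
    obtain ⟨s', t', h3, h4, h5⟩ := exists_Icc_subset_of_eventually hst hs h2
    exact ⟨s', t', h3, h4, _, h5⟩
  · push Not at hint
    obtain ⟨x, hx, hne⟩ := hint
    have h1 : ∀ᶠ y in 𝓝[Icc s t] x, f y ∈ Ioo (⌊f x⌋ : ℝ) (⌊f x⌋ + 1) :=
      (hf x hx).eventually (Ioo_mem_nhds (lt_of_le_of_ne (Int.floor_le _) hne.symm)
        (Int.lt_floor_add_one _))
    obtain ⟨s', t', h3, h4, h5⟩ := exists_Icc_subset_of_eventually hst hx h1
    exact ⟨s', t', h3, h4, _, fun y hy => Int.floor_eq_iff.2 ⟨(h5 y hy).1.le, (h5 y hy).2⟩⟩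

lemma isClosed_closedCell (o : Plane) : IsClosed (closedCell o) := by
  have : closedCell o = ⋂ j : Fin 2, {x : Plane | o j ≤ x j ∧ x j ≤ o j + 1} := by
    ext x; simp [closedCell]
  rw [this]
  refine isClosed_iInter fun j => ?_
  have hc : Continuous fun x : Plane => x j := (EuclideanSpace.proj (𝕜 := ℝ) j).continuous
  exact (isClosed_le continuous_const hc).inter (isClosed_le hc continuous_const)

lemma latticeVec_apply (n : Fin 2 → ℤ) (j : Fin 2) : latticeVec n j = n j := rfl

lemma sub_latticeVec_cellIndex_mem (o y : Plane) : y - latticeVec (cellIndex o y) ∈ closedCell o := by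
  intro j
  have h1 := Int.floor_le (y j - o j)
  have h2 := Int.lt_floor_add_one (y j - o j)
  rw [PiLp.sub_apply, latticeVec_apply]
  simp only [cellIndex]
  constructor <;> linarith

namespace TorusPattern

variable {ι : Type*} (P : TorusPattern ι)

/-! ### Pieces of arcs in a cell, and lattice translates of arcs -/

lemma continuousOn_arc_apply (i : ι) (k : Fin 2) :
    ContinuousOn (fun t => P.arc i t k) (Icc 0 (P.len i)) :=
  (EuclideanSpace.proj (𝕜 := ℝ) k).continuous.comp_continuousOn (P.continuousOn_arc i)

/-- Every stretch of an arc contains a piece of the pattern in the cell. -/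
lemma exists_isPiece_subset (o : Plane) (i : ι) {s t : ℝ} (hst : s < t)
    (hsub : Icc s t ⊆ Icc 0 (P.len i)) :
    ∃ n s' t', P.IsPiece o i n s' t' ∧ Icc s' t' ⊆ Icc s t := by
  obtain ⟨s₁, t₁, h₁, hs₁, m₀, hm₀⟩ := exists_Icc_subset_floor_eq hst
    (((P.continuousOn_arc_apply i 0).mono hsub).sub continuousOn_const (g := fun _ => o 0))
  obtain ⟨s₂, t₂, h₂, hs₂, m₁, hm₁⟩ := exists_Icc_subset_floor_eq h₁
    (((P.continuousOn_arc_apply i 1).mono (hs₁.trans hsub)).sub continuousOn_const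
      (g := fun _ => o 1))
  have hidx : ∀ x ∈ Icc s₂ t₂, cellIndex o (P.arc i x) = ![m₀, m₁] := fun x hx => by
    funext j
    fin_cases j
    · exact hm₀ x (hs₂ hx)
    · exact hm₁ x hx
  refine ⟨![m₀, m₁], s₂, t₂, ⟨h₂, (hs₂.trans hs₁).trans hsub, fun x hx => ?_, ?_⟩, hs₂.trans hs₁⟩
  · rw [← hidx x hx]
    exact sub_latticeVec_cellIndex_mem o _
  · exact (ae_restrict_iff' measurableSet_Icc).2 (Eventually.of_forall hidx)

/-- The arc `i`, moved by `-n`. -/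
def movedArc (i : ι) (n : Fin 2 → ℤ) : Set Plane :=
  (fun t => P.arc i t - latticeVec n) '' Icc 0 (P.len i)

lemma isClosed_movedArc (i : ι) (n : Fin 2 → ℤ) : IsClosed (P.movedArc i n) :=
  (isCompact_Icc.image_of_continuousOn
    ((P.continuousOn_arc i).sub continuousOn_const)).isClosed

/-- Arcs and cell are bounded, so only finitely many translates matter. Finiteness makes unions of
such arcs closed, as the connectedness argument requires. -/
lemma finite_movedArc_inter_closedCell [Finite ι] (o : Plane) :
    {q : ι × (Fin 2 → ℤ) | (P.movedArc q.1 q.2 ∩ closedCell o).Nonempty}.Finite := by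
  have hB : ∀ i, ∃ B : ℝ, ∀ t ∈ Icc 0 (P.len i), ‖P.arc i t‖ ≤ B := fun i =>
    isCompact_Icc.exists_bound_of_continuousOn (P.continuousOn_arc i)
  choose B hB using hB
  have hsub : {q : ι × (Fin 2 → ℤ) | (P.movedArc q.1 q.2 ∩ closedCell o).Nonempty}
      ⊆ ⋃ i, (Prod.mk i) '' Icc (fun k => ⌊-B i - o k - 1⌋) (fun k => ⌈B i - o k⌉) := by
    rintro ⟨i, n⟩ ⟨_, ⟨t, ht, rfl⟩, hc⟩
    refine mem_iUnion.2 ⟨i, n, ⟨fun k => ?_, fun k => ?_⟩, rfl⟩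
    all_goals
      have h1 := abs_le.1 ((PiLp.norm_apply_le (P.arc i t) k).trans (hB i t ht))
      have h2 := hc k
      simp only [PiLp.sub_apply, latticeVec_apply] at h2
    · refine Int.cast_le.1 ((Int.floor_le _).trans (?_ : _ ≤ ((n k : ℤ) : ℝ)))
      linarith
    · refine Int.cast_le.1 (le_trans (?_ : ((n k : ℤ) : ℝ) ≤ _) (Int.le_ceil _))
      linarith
  exact (finite_iUnion fun i => (finite_Icc _ _).image _).subset hsub

lemma integral_tangent_sq_add (i : ι) :
    (∫ t in (0 : ℝ)..P.len i, P.tangent i t 0 * P.tangent i t 0)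
      + ∫ t in (0 : ℝ)..P.len i, P.tangent i t 1 * P.tangent i t 1 = P.len i := by
  have hc : ∀ k, ContinuousOn (fun t => P.tangent i t k * P.tangent i t k)
      (uIcc 0 (P.len i)) := fun k => by
    rw [uIcc_of_le (P.len_pos i).le]
    have := (EuclideanSpace.proj (𝕜 := ℝ) k).continuous.comp_continuousOn
      (P.continuousOn_tangent i)
    exact this.mul this
  rw [← intervalIntegral.integral_add (hc 0).intervalIntegrable (hc 1).intervalIntegrable]
  have h1 : ∫ t in (0 : ℝ)..P.len i, (P.tangent i t 0 * P.tangent i t 0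
      + P.tangent i t 1 * P.tangent i t 1) = ∫ t in (0 : ℝ)..P.len i, (1 : ℝ) := by
    refine intervalIntegral.integral_congr fun t ht => ?_
    rw [uIcc_of_le (P.len_pos i).le] at ht
    have h2 : ‖P.tangent i t‖ ^ 2 = 1 := by
      rw [show ‖P.tangent i t‖ = 1 from P.unit_speed i t ht, one_pow]
    rw [EuclideanSpace.norm_sq_eq, Fin.sum_univ_two] at h2
    simp only [Real.norm_eq_abs, sq_abs] at h2
    simp only
    linarith
  rw [h1]
  simp

lemma eq_endParam_of_eq_or {i : ι} {s : ℝ} (h : s = 0 ∨ s = P.len i) :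
    ∃ e, s = P.endParam i e := by
  rcases h with h | h
  · exact ⟨false, h⟩
  · exact ⟨true, h⟩

variable [Fintype ι]

/-! ### The distances do not depend on the origin of the cell -/

/-- The projection removes an element of the closure of `K¹`, and derivatives vanish on that closure
too, because taking the derivative is continuous. -/
lemma snd_cellProj (o : Plane) (p : P.GraphL2) : (P.cellProj o p).snd = p.snd := by
  have h1 : p - (P.kernelSpace o)ᗮ.starProjection p ∈ (P.kernelSpace o)ᗮᗮ :=
    Submodule.sub_starProjection_mem_orthogonal p
  rw [Submodule.orthogonal_orthogonal_eq_closure] at h1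
  have h2 : (P.kernelSpace o).topologicalClosure
      ≤ LinearMap.ker (WithLp.sndₗ 2 ℝ P.ArcL2 P.ArcL2) := by
    refine Submodule.topologicalClosure_minimal _ inf_le_right ?_
    exact isClosed_singleton.preimage (WithLp.sndL 2 ℝ P.ArcL2 P.ArcL2).continuous
  have h3 : p.snd - ((P.kernelSpace o)ᗮ.starProjection p).snd = 0 := h2 h1
  exact (sub_eq_zero.1 h3).symm

lemma image_snd_perSubspace (o : Plane) :
    (fun p : P.GraphL2 => p.snd) '' (P.perSubspace o : Set P.GraphL2) = P.perDerivs := by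
  ext g
  constructor
  · rintro ⟨_, ⟨p, hp, rfl⟩, rfl⟩
    exact ⟨p, hp, (P.snd_cellProj o p).symm⟩
  · rintro ⟨p, hp, rfl⟩
    exact ⟨_, ⟨p, hp, rfl⟩, P.snd_cellProj o p⟩

/-- Only derivatives enter the distance, and neither `(x_k)_s` nor the derivatives of periodic
functions depend on the origin of the cell. -/
lemma cellDist_eq (o : Plane) (k : Fin 2) :
    P.cellDist o k = Metric.infDist (P.tangentL2 k) P.perDerivs := by
  rw [cellDist, image_snd_perSubspace, snd_cellProj]
  rfl

/-! ### The derivatives of periodic functions form a closed space -/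

/-- The functions on the arc ends that are single-valued at the nodes of the torus. -/
def nodeFunctions : Submodule ℝ (ι × Bool → ℝ) where
  carrier := {h | ∀ i e j e', ∀ n : Fin 2 → ℤ, P.endPoint i e = P.endPoint j e' + latticeVec n →
    h (i, e) = h (j, e')}
  zero_mem' _ _ _ _ _ _ := rfl
  add_mem' hf hg i e j e' n hn := by
    rw [Pi.add_apply, Pi.add_apply, hf i e j e' n hn, hg i e j e' n hn]
  smul_mem' c f hf i e j e' n hn := by
    rw [Pi.smul_apply, Pi.smul_apply, hf i e j e' n hn]

/-- The increments along the arcs of a function on the arc ends. -/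
def incrementMap : (ι × Bool → ℝ) →ₗ[ℝ] ι → ℝ where
  toFun h i := h (i, true) - h (i, false)
  map_add' f g := by funext i; simp only [Pi.add_apply]; ring
  map_smul' c f := by funext i; simp only [Pi.smul_apply, smul_eq_mul, RingHom.id_apply]; ring

/-- The integrals over the arcs. -/
def arcIntegrals : P.ArcL2 →L[ℝ] (ι → ℝ) :=
  ContinuousLinearMap.pi fun i => arcIntegralCLM (P.len i) 0 (P.len i) ∘L
    PiLp.proj 2 (fun i : ι => Lp ℝ 2 (arcMeasure (P.len i))) i

lemma arcIntegrals_apply (g : P.ArcL2) (i : ι) :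
    P.arcIntegrals g i = ∫ t in (0 : ℝ)..P.len i, g i t :=
  arcIntegralCLM_apply le_rfl (P.len_pos i).le le_rfl (g i)

/-- Periodicity constrains `g` only through its integrals over the arcs: these must be the
increments of a single-valued node function. As a preimage of a finite-dimensional subspace, the
space is closed. -/
lemma perDerivs_eq_preimage :
    (P.perDerivs : Set P.ArcL2) = P.arcIntegrals ⁻¹' (P.nodeFunctions.map incrementMap) := by
  ext g
  constructor
  · rintro ⟨p, ⟨u, hu⟩, rfl⟩
    refine ⟨fun q => u q.1 (P.endParam q.1 q.2), fun i e j e' n hn => hu.match_nodes i e j e' n hn,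
      funext fun i => ?_⟩
    exact (hu.eq_integral i 0 (left_mem_Icc.2 (P.len_pos i).le) (P.len i)
      (right_mem_Icc.2 (P.len_pos i).le)).trans (P.arcIntegrals_apply _ i).symm
  · rintro ⟨h, hh, hg⟩
    refine P.mem_perDerivs_of_match (g, fun i => h (i, false)) fun i e j e' n hn => ?_
    have key : ∀ i e, P.primitive (g, fun i => h (i, false)) i (P.endParam i e) = h (i, e) := by
      intro i e
      cases e
      · simp [primitive, endParam]
      · have h1 : h (i, true) - h (i, false) = P.arcIntegrals g i := congrFun hg i
        rw [arcIntegrals_apply] at h1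
        simp only [primitive, endParam, if_true]
        rw [← h1]
        ring
    rw [key, key]
    exact hh i e j e' n hn

lemma isClosed_perDerivs : IsClosed (P.perDerivs : Set P.ArcL2) := by
  rw [perDerivs_eq_preimage]
  exact (Submodule.closed_of_finiteDimensional _).preimage P.arcIntegrals.continuous

/-! ### The length of the coordinate derivatives -/

lemma norm_tangentL2_sq_add :
    ‖P.tangentL2 0‖ ^ 2 + ‖P.tangentL2 1‖ ^ 2 = P.totalLength := by
  rw [← real_inner_self_eq_norm_sq, ← real_inner_self_eq_norm_sq,
    P.inner_arcL2 (P.coeFn_tangentL2 0) (P.coeFn_tangentL2 0),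
    P.inner_arcL2 (P.coeFn_tangentL2 1) (P.coeFn_tangentL2 1), ← Finset.sum_add_distrib]
  exact Finset.sum_congr rfl fun i _ => P.integral_tangent_sq_add i

/-! ### Periodic functions with the derivatives of the coordinates -/

variable {P}

lemma IsPerRep.sub_eq_coord_sub {p : P.GraphL2} {u : ι → ℝ → ℝ} (hu : P.IsPerRep p u) {k : Fin 2}
    (hp : p.snd = P.tangentL2 k) (i : ι) {s t : ℝ} (hs : s ∈ Icc 0 (P.len i))
    (ht : t ∈ Icc 0 (P.len i)) : u i t - u i s = P.arc i t k - P.arc i s k := by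
  have hL := P.len_pos i
  have h0 : (0 : ℝ) ∈ Icc 0 (P.len i) := left_mem_Icc.2 hL.le
  have key : ∀ t ∈ Icc 0 (P.len i), u i t - u i 0 = P.arc i t k - P.arc i 0 k := by
    intro t ht
    rw [hu.eq_integral i 0 h0 t ht, hp,
      intervalIntegral.integral_congr_ae (ae_of_ae_Icc h0 ht (P.coeFn_tangentL2 k i))]
    refine intervalIntegral.integral_eq_sub_of_hasDeriv_right_of_le ht.1
      ((P.continuousOn_arc_apply i k).mono (Icc_subset_Icc_right ht.2)) (fun x hx => ?_) ?_
    · have hx' : x ∈ Icc 0 (P.len i) := ⟨hx.1.le, hx.2.le.trans ht.2⟩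
      exact (((P.hasDerivWithinAt_arc i hx').hasDerivAt
        (Icc_mem_nhds hx.1 (hx.2.trans_le ht.2))).planePoint_apply k).hasDerivWithinAt
    · refine ContinuousOn.intervalIntegrable ?_
      rw [uIcc_of_le ht.1]
      exact ((EuclideanSpace.proj (𝕜 := ℝ) k).continuous.comp_continuousOn
        (P.continuousOn_tangent i)).mono (Icc_subset_Icc_right ht.2)
  have h1 := key s hs
  have h2 := key t ht
  linarith

section Potential

variable {p : Fin 2 → P.GraphL2} {u : Fin 2 → ι → ℝ → ℝ}

/-- `x_k - u_k` is constant along each moved arc. A common point is either the same point of the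
same arc or a node, and `u_k` is single-valued at nodes, so the two constants agree. -/
lemma coord_sub_eq_of_movedArc_inter (hu : ∀ k, P.IsPerRep (p k) (u k))
    (hp : ∀ k, (p k).snd = P.tangentL2 k) {i j : ι} {n m : Fin 2 → ℤ}
    (h : (P.movedArc i n ∩ P.movedArc j m).Nonempty) (k : Fin 2) :
    P.arc i 0 k - u k i 0 - n k = P.arc j 0 k - u k j 0 - m k := by
  obtain ⟨_, ⟨s, hs, rfl⟩, t, ht, hst⟩ := h
  simp only at hst
  have hst' : P.arc i s = P.arc j t + latticeVec (n - m) := by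
    have : latticeVec (n - m) = latticeVec n - latticeVec m := by
      ext l; simp [latticeVec]
    rw [this, ← sub_add_cancel (P.arc i s) (latticeVec n), ← hst]
    abel
  have hk : P.arc i s k = P.arc j t k + (n k - m k) := by
    have := congrArg (fun y : Plane => y k) hst'
    simpa [latticeVec] using this
  have hi := (hu k).sub_eq_coord_sub (hp k) i (left_mem_Icc.2 (P.len_pos i).le) hs
  have hj := (hu k).sub_eq_coord_sub (hp k) j (left_mem_Icc.2 (P.len_pos j).le) ht
  have hval : u k i s = u k j t := by
    rcases P.meet_at_ends i j s hs t ht _ hst' with ⟨rfl, rfl⟩ | ⟨h1, h2⟩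
    · rfl
    · obtain ⟨e, rfl⟩ := P.eq_endParam_of_eq_or h1
      obtain ⟨e', rfl⟩ := P.eq_endParam_of_eq_or h2
      exact (hu k).match_nodes i e j e' _ hst'
  linarith

/-- On a connected pattern the coordinates differ from periodic functions with the same
derivatives by constants. -/
lemma coord_sub_eq_of_isPiece {o : Plane} (hconn : IsConnected (P.cellGraph o))
    (hu : ∀ k, P.IsPerRep (p k) (u k)) (hp : ∀ k, (p k).snd = P.tangentL2 k) {i j : ι}
    {n m : Fin 2 → ℤ} {s t s' t' : ℝ} (h : P.IsPiece o i n s t) (h' : P.IsPiece o j m s' t')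
    (k : Fin 2) : P.arc i 0 k - u k i 0 - n k = P.arc j 0 k - u k j 0 - m k := by
  -- The constant value of `x_k - u_k` on the moved arc `q`.
  set c : ι × (Fin 2 → ℤ) → ℝ := fun q => P.arc q.1 0 k - u k q.1 0 - q.2 k with hc
  set F := {q : ι × (Fin 2 → ℤ) | (P.movedArc q.1 q.2 ∩ closedCell o).Nonempty} with hF
  have hFfin : F.Finite := P.finite_movedArc_inter_closedCell o
  have hpiece : ∀ {i n s t x}, P.IsPiece o i n s t → x ∈ Icc s t →
      (i, n) ∈ F ∧ P.arc i x - latticeVec n ∈ P.movedArc i n := fun h hx =>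
    ⟨⟨_, ⟨_, h.2.1 hx, rfl⟩, h.2.2.1 _ hx⟩, ⟨_, h.2.1 hx, rfl⟩⟩
  by_contra hne
  have hcl : ∀ Q : ι × (Fin 2 → ℤ) → Prop,
      IsClosed (⋃ q ∈ {q ∈ F | Q q}, P.movedArc q.1 q.2) := fun Q =>
    (hFfin.subset (sep_subset _ _)).isClosed_biUnion fun q _ => P.isClosed_movedArc q.1 q.2
  have hmem : ∀ (Q : ι × (Fin 2 → ℤ) → Prop) {i n s t x}, P.IsPiece o i n s t → x ∈ Icc s t →
      Q (i, n) → P.arc i x - latticeVec n ∈ ⋃ q ∈ {q ∈ F | Q q}, P.movedArc q.1 q.2 :=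
    fun Q i n s t x h hx hQ =>
      mem_biUnion (x := (i, n)) ⟨(hpiece h hx).1, hQ⟩ (hpiece h hx).2
  have hgraph : ∀ {i n s t}, P.IsPiece o i n s t → P.arc i s - latticeVec n ∈ P.cellGraph o :=
    fun h => ⟨_, _, _, _, h, _, left_mem_Icc.2 h.1.le, rfl⟩
  -- The arcs with the constant of the first piece and the remaining arcs form two closed sets
  -- covering the connected graph. If both met it, they would share a point `y`, where the constants
  -- must agree.
  obtain ⟨y, -, hy1, hy2⟩ := isPreconnected_closed_iff.1 hconn.isPreconnected _ _
    (hcl fun q => c q = c (i, n)) (hcl fun q => c q ≠ c (i, n))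
    (by
      rintro _ ⟨i', n', s₁, t₁, h₁, x, hx, rfl⟩
      by_cases hcc : c (i', n') = c (i, n)
      · exact Or.inl (hmem _ h₁ hx hcc)
      · exact Or.inr (hmem (fun q => c q ≠ c (i, n)) h₁ hx hcc))
    ⟨_, hgraph h, hmem _ h (left_mem_Icc.2 h.1.le) rfl⟩
    ⟨_, hgraph h', hmem (fun q => c q ≠ c (i, n)) h' (left_mem_Icc.2 h'.1.le) (Ne.symm hne)⟩
  obtain ⟨q₁, ⟨-, hq₁⟩, hyq₁⟩ := mem_iUnion₂.1 hy1
  obtain ⟨q₂, ⟨-, hq₂⟩, hyq₂⟩ := mem_iUnion₂.1 hy2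
  exact hq₂ ((coord_sub_eq_of_movedArc_inter hu hp ⟨y, hyq₂, hyq₁⟩ k).trans hq₁)

end Potential

/-- Otherwise `x_k - u_k` is one constant on the whole graph in the cell, so all pieces of one arc
carry the same lattice index and the arc stays in one closed cell. Along a closed arc `u_k` returns
to its value, so `x_k` does too and the arc does not wind. -/
lemma not_forall_tangentL2_mem_perDerivs {o : Plane} (hconn : IsConnected (P.cellGraph o))
    (hcross : ∃ i, P.ArcCrosses o i) : ¬ ∀ k, P.tangentL2 k ∈ P.perDerivs := by
  intro hmem
  choose p hper hp using hmem
  choose u hu using hper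
  obtain ⟨i, hi⟩ := hcross
  have hL := P.len_pos i
  rcases hi with hi | ⟨n, hn, hni⟩
  · obtain ⟨n, s, t, hpc, -⟩ := P.exists_isPiece_subset o i hL Subset.rfl
    refine hi ⟨n, ?_⟩
    by_contra! hcon
    obtain ⟨x, hx, hxn⟩ := hcon
    -- If the arc left the cell of index `n` at `x`, it would do so along a whole stretch; a piece
    -- inside that stretch has index `n` by connectedness, hence lies in that cell.
    have hev : ∀ᶠ y in 𝓝[Icc 0 (P.len i)] x, P.arc i y - latticeVec n ∉ closedCell o :=
      (((P.continuousOn_arc i).sub continuousOn_const) x hx).eventually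
        ((isClosed_closedCell o).isOpen_compl.mem_nhds hxn)
    obtain ⟨s₁, t₁, h1, h2, h3⟩ := exists_Icc_subset_of_eventually hL hx hev
    obtain ⟨m, s₂, t₂, hpm, hsub⟩ := P.exists_isPiece_subset o i h1 h2
    have hnm : n = m := by
      funext k
      have := coord_sub_eq_of_isPiece hconn hu hp hpc hpm k
      have h4 : (n k : ℝ) = m k := by linarith
      exact_mod_cast h4
    have hs₂ := left_mem_Icc.2 hpm.1.le
    exact h3 s₂ (hsub hs₂) (hnm ▸ hpm.2.2.1 s₂ hs₂)
  · refine hn (funext fun k => ?_)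
    have h1 : u k i (P.len i) = u k i 0 := (hu k).match_nodes i true i false n hni
    have h2 := (hu k).sub_eq_coord_sub (hp k) i (left_mem_Icc.2 hL.le) (right_mem_Icc.2 hL.le)
    have h3 : P.arc i (P.len i) k = P.arc i 0 k + n k := congrArg (fun y : Plane => y k) hni
    have h4 : (n k : ℝ) = 0 := by linarith
    exact_mod_cast h4

end TorusPattern

namespace TorusPattern

variable {ι : Type*} [Fintype ι] (P : TorusPattern ι)

/-! ### The maximal distance -/

/-- The number `d² = d₁² + d₂²`. -/
def distSq : ℝ := Metric.infDist (P.tangentL2 0) P.perDerivs ^ 2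
  + Metric.infDist (P.tangentL2 1) P.perDerivs ^ 2

variable {P} in
lemma distSq_pos {o : Plane} (hconn : IsConnected (P.cellGraph o))
    (hcross : ∃ i, P.ArcCrosses o i) : 0 < P.distSq := by
  have h0 : 0 ≤ P.distSq := add_nonneg (sq_nonneg _) (sq_nonneg _)
  refine lt_of_le_of_ne h0 fun h => not_forall_tangentL2_mem_perDerivs hconn hcross fun k => ?_
  rw [← SetLike.mem_coe,
    P.isClosed_perDerivs.mem_iff_infDist_zero ⟨0, P.perDerivs.zero_mem⟩]
  obtain ⟨h1, h2⟩ := (add_eq_zero_iff_of_nonneg (sq_nonneg _) (sq_nonneg _)).1 h.symm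
  fin_cases k
  · exact pow_eq_zero_iff two_ne_zero |>.1 h1
  · exact pow_eq_zero_iff two_ne_zero |>.1 h2

lemma distSq_le_totalLength : P.distSq ≤ P.totalLength := by
  have h : ∀ k, Metric.infDist (P.tangentL2 k) P.perDerivs ^ 2 ≤ ‖P.tangentL2 k‖ ^ 2 := fun k =>
    pow_le_pow_left₀ Metric.infDist_nonneg
      ((Metric.infDist_le_dist_of_mem P.perDerivs.zero_mem).trans_eq (dist_zero_right _)) 2
  rw [← norm_tangentL2_sq_add]
  exact add_le_add (h 0) (h 1)

/-! ### The effective tensor -/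

section Tensor

variable {a : ℝ} [(P.energySubmodule a).HasOrthogonalProjection]

/-- The component of the source orthogonal to `Z`. -/
def energyResidual (a : ℝ) [(P.energySubmodule a).HasOrthogonalProjection] (k : Fin 2) :
    P.EnergySpace :=
  P.energySource a k - (P.energySubmodule a).starProjection (P.energySource a k)

lemma exists_isCorrector (ha : 0 ≤ a) (k : Fin 2) : ∃ w, P.IsCorrector a k w := by
  obtain ⟨z, hz, hzk⟩ := neg_mem
    ((P.energySubmodule a).starProjection_apply_mem (P.energySource a k))
  refine ⟨P.toCellField z, (P.isCorrector_iff ha k _).2 ⟨P.memZ_toCellField hz, ?_⟩⟩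
  rw [P.toField_toCellField hz, ← neg_eq_iff_eq_neg]
  exact hzk.symm

variable {P} in
-- The residual is source plus image of `w`, and pairing with a source, whose gradient part is zero,
-- leaves the arc integral alone. The right side does not involve `w`, which gives uniqueness of the
-- tensor.
lemma IsCorrector.tensor_entry (ha : 0 ≤ a) {k : Fin 2} {w : CellField ι}
    (hw : P.IsCorrector a k w) (l : Fin 2) :
    a * ∑ i, ∫ t in (0 : ℝ)..P.len i, (w.traceDeriv i t + P.tangent i t k) * P.tangent i t l
      = inner ℝ (P.energyResidual a k) (P.energySource a l) := by
  obtain ⟨h, hproj⟩ := (P.isCorrector_iff ha k w).1 hw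
  have h1 : P.energyResidual a k = WithLp.toLp 2
      (h.toField.2.1, Real.sqrt a • (h.toField.2.2.1 + P.tangentL2 k)) := by
    rw [energyResidual, hproj, sub_neg_eq_add, P.energyMap_apply, energySource, smul_add,
      ← WithLp.toLp_add, Prod.mk_add_mk, zero_add, add_comm]
  rw [h1, energySource, P.inner_energySpace ha, inner_zero_right, zero_add]
  congr 1
  refine (P.inner_arcL2 (fun i => ?_) (P.coeFn_tangentL2 l)).symm
  filter_upwards [Lp.coeFn_add (h.toField.2.2.1 i) (P.tangentL2 k i), h.coeFn_toField i,
    P.coeFn_tangentL2 k i] with t e1 e2 e3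
  refine e1.trans ?_
  rw [Pi.add_apply, e2, e3]

/-- The residual is orthogonal to the projection; the diagonal entries of the tensor, less one, thus
become squared norms. -/
lemma inner_energyResidual_energySource (k : Fin 2) :
    inner ℝ (P.energyResidual a k) (P.energySource a k) = ‖P.energyResidual a k‖ ^ 2 := by
  have h := Submodule.starProjection_inner_eq_zero (K := P.energySubmodule a)
    (P.energySource a k) _ ((P.energySubmodule a).starProjection_apply_mem (P.energySource a k))
  have h2 : inner ℝ (P.energyResidual a k) (P.energyResidual a k)
      = inner ℝ (P.energyResidual a k) (P.energySource a k)
        - inner ℝ (P.energyResidual a k)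
          ((P.energySubmodule a).starProjection (P.energySource a k)) := by
    rw [← inner_sub_right]
    rfl
  rw [← real_inner_self_eq_norm_sq, h2]
  exact (sub_eq_self.2 h).symm

lemma norm_energyResidual_sq_le (ha : 0 ≤ a) (k : Fin 2) :
    ‖P.energyResidual a k‖ ^ 2 ≤ a * ‖P.tangentL2 k‖ ^ 2 := by
  have h1 : ‖P.energySource a k‖ ^ 2 = a * ‖P.tangentL2 k‖ ^ 2 := by
    rw [← real_inner_self_eq_norm_sq, energySource, P.inner_energySpace ha, inner_zero_right,
      zero_add, real_inner_self_eq_norm_sq]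
  have h2 := real_inner_le_norm (P.energyResidual a k) (P.energySource a k)
  rw [inner_energyResidual_energySource] at h2
  nlinarith [sq_nonneg (‖P.energyResidual a k‖ - ‖P.energySource a k‖)]

/-- The residual is `(-∇z, √a ((x_k)_s - z_s))` for some `z` in `Z`. Drop the gradient part; `z_s`
is the derivative of a periodic function on the graph, so what remains is at least the distance. -/
lemma le_norm_energyResidual_sq (ha : 0 ≤ a) (k : Fin 2) :
    a * Metric.infDist (P.tangentL2 k) P.perDerivs ^ 2 ≤ ‖P.energyResidual a k‖ ^ 2 := by
  obtain ⟨z, hz, hzk⟩ := (P.energySubmodule a).starProjection_apply_mem (P.energySource a k)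
  have h1 : P.energyResidual a k
      = WithLp.toLp 2 (-z.2.1, Real.sqrt a • (P.tangentL2 k - z.2.2.1)) := by
    rw [energyResidual, ← hzk]
    change P.energySource a k - P.energyMap a z = _
    rw [P.energyMap_apply, energySource, smul_sub, ← WithLp.toLp_sub, Prod.mk_sub_mk, zero_sub]
  rw [← real_inner_self_eq_norm_sq, h1, P.inner_energySpace ha, real_inner_self_eq_norm_sq,
    real_inner_self_eq_norm_sq]
  have h2 := Metric.infDist_le_dist_of_mem (x := P.tangentL2 k)
    (P.snd_mem_perDerivs_of_mem_fieldSubmodule hz)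
  rw [dist_eq_norm] at h2
  have h3 := mul_le_mul_of_nonneg_left (pow_le_pow_left₀ Metric.infDist_nonneg h2 2) ha
  exact h3.trans (le_add_of_nonneg_left (sq_nonneg _))

lemma isEffectiveTensor_iff (ha : 0 ≤ a) (S : Matrix (Fin 2) (Fin 2) ℝ) :
    P.IsEffectiveTensor a S ↔ ∀ k l, S k l = (if k = l then 1 else 0)
      + inner ℝ (P.energyResidual a k) (P.energySource a l) := by
  constructor
  · rintro ⟨w, hw, hS⟩ k l
    rw [hS, (hw k).tensor_entry ha]
  · intro hS
    choose w hw using P.exists_isCorrector (a := a) ha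
    exact ⟨w, hw, fun k l => by rw [hS, (hw k).tensor_entry ha]⟩

end Tensor

/-! ### Conclusion -/

lemma existsUnique_isEffectiveTensor_and_bounds {a : ℝ} (ha : 0 < a) :
    (∃! S : Matrix (Fin 2) (Fin 2) ℝ, P.IsEffectiveTensor a S) ∧
      ∀ S : Matrix (Fin 2) (Fin 2) ℝ, P.IsEffectiveTensor a S →
        2 + P.distSq * a ≤ S.trace ∧ S.trace ≤ 2 + P.totalLength * a := by
  have : CompleteSpace (P.energySubmodule a) :=
    (P.isClosed_energySubmodule ha).isComplete.completeSpace_coe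
  have : (P.energySubmodule a).HasOrthogonalProjection :=
    Submodule.HasOrthogonalProjection.ofCompleteSpace _
  refine ⟨⟨fun k l => (if k = l then 1 else 0)
      + inner ℝ (P.energyResidual a k) (P.energySource a l),
    (P.isEffectiveTensor_iff ha.le _).2 fun _ _ => rfl, fun S hS => ?_⟩, fun S hS => ?_⟩
  · ext k l
    exact (P.isEffectiveTensor_iff ha.le S).1 hS k l
  · have h := (P.isEffectiveTensor_iff ha.le S).1 hS
    rw [Matrix.trace_fin_two, h, h, inner_energyResidual_energySource,
      inner_energyResidual_energySource, ← norm_tangentL2_sq_add, distSq]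
    simp only [if_true]
    have l0 := P.le_norm_energyResidual_sq ha.le 0
    have l1 := P.le_norm_energyResidual_sq ha.le 1
    have u0 := P.norm_energyResidual_sq_le ha.le 0
    have u1 := P.norm_energyResidual_sq_le ha.le 1
    constructor <;> linarith

end TorusPattern

end

theorem mainTheorem4 {ι : Type*} [Fintype ι] (P : TorusPattern ι) (hreg : P.IsRegular)
    (o : Plane) (hconn : IsConnected (P.cellGraph o)) (hcross : ∃ i, P.ArcCrosses o i) :
    ∃ d : ℝ,
      IsGreatest (Set.range fun o' : Plane => P.cellDist o' 0 ^ 2 + P.cellDist o' 1 ^ 2) (d ^ 2) ∧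
      0 < d ∧ d ≤ Real.sqrt P.totalLength ∧
      ∀ a : ℝ, 0 < a →
        (∃! S : Matrix (Fin 2) (Fin 2) ℝ, P.IsEffectiveTensor a S) ∧
        ∀ S : Matrix (Fin 2) (Fin 2) ℝ, P.IsEffectiveTensor a S →
          2 + d ^ 2 * a ≤ S.trace ∧ S.trace ≤ 2 + P.totalLength * a := by
  -- The quantity to be maximized is constant in `o'`, so any origin attains the maximum.
  have hd : ∀ o' : Plane, P.cellDist o' 0 ^ 2 + P.cellDist o' 1 ^ 2 = P.distSq := fun o' => by
    rw [P.cellDist_eq, P.cellDist_eq, TorusPattern.distSq]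
  have hpos := TorusPattern.distSq_pos hconn hcross
  refine ⟨Real.sqrt P.distSq, ?_, Real.sqrt_pos.2 hpos,
    Real.sqrt_le_sqrt P.distSq_le_totalLength, fun a ha => ?_⟩
  · rw [Real.sq_sqrt hpos.le]
    refine ⟨⟨o, hd o⟩, ?_⟩
    rintro _ ⟨o', rfl⟩
    exact (hd o').le
  · rw [Real.sq_sqrt hpos.le]
    exact P.existsUnique_isEffectiveTensor_and_bounds ha
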